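/- Let $\alpha\in\mathbb R$ be irrational and let $\mathbb A_{2\alpha}$ be the noncommutative torus, i.e. the universal unital $C^*$-algebra generated by two unitaries $U,V$ with $UV=e^{4\pi i\alpha}VU$. Put $W(m,n)=e^{-2\pi i\alpha mn}U^mV^n$ and $W(f)=\sum_{m,n}f(m,n)W(m,n)$ for finitely supported $f:\mathbb Z^2\to\mathbb C$. Let $\mu$ be a Borel probability measure on the circle $\mathbb T$, let $R$ be the rotation of $\mathbb T$ by the angle $2\pi\alpha$, and let $\mu_n=\mu\circ R^{-n}$ for $n\in\mathbb Z$. There is a unique positive linear functional $\omega_\mu$ on $\mathbb A_{2\alpha}$ (a state) with $$\omega_\mu(W(f))=\sum_{m\in\mathbb Z}f(m,0)\int_{\mathbb T}z^m\,d\mu(z)$$ for all finitely supported $f$. Its GNS Hilbert space is identified with $\mathcal H=\bigoplus_{n\in\mathbb Z}L^2(\mathbb T,\mu_n)$ through the unitary that sends $\pi_{\omega_\mu}(W(f))\xi_{\omega_\mu}$ to the vector with components $z\mapsto\sum_{m}f(m,n)z^m$, $n\in\mathbb Z$. Let $S$ be the closure of the conjugate-linear map $\pi_{\omega_\mu}(a)\xi_{\omega_\mu}\mapsto\pi_{\omega_\mu}(a^*)\xi_{\omega_\mu}$,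 $a\in\mathbb A_{2\alpha}$, and let $S=J\Delta^{1/2}$ be its polar decomposition, where $J$ is antiunitary and $\Delta^{1/2}$ is the positive self-adjoint square root of $\Delta$; $\Delta$ and $J$ are the Tomita modular operator and conjugation of $\omega_\mu$. **Theorem.** Suppose that $\mu_{-n}\sim\mu_n$ (mutual absolute continuity) for all $n\in\mathbb Z$, with Radon–Nikodym derivatives $h_n=\frac{d\mu_{-n}}{d\mu_n}$. Then $\Delta$ and $J$ exist, and $$\mathcal D_\Delta=\Big\{x\in\mathcal H\ \Big|\ \sum_{n\in\mathbb Z}\int_{\mathbb T}|h_n(z)x_n(z)|^2\,d\mu_n(z)<\infty\Big\},$$ $$(\Delta x)_n(z)=h_n(z)\,x_n(z)\quad(x\in\mathcal D_\Delta),\qquad (Jx)_n(z)=h_n(z)^{1/2}\,\overline{x_{-n}(z)}\quad(x\in\mathcal H),$$ for every $n\in\mathbb Z$ and $\mu_n$-almost every $z\in\mathbb T$. -/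

import Mathlib

open MeasureTheory
open scoped ENNReal ComplexConjugate InnerProductSpace ComplexOrder

noncomputable section

/-! ### The noncommutative torus -/

/-- A nonzero unital C⋆-algebra `B` with unitaries `u`, `v` such that `u v = e^{4πiα} v u`. -/
structure TorusPair (α : ℝ) where
  /-- The C⋆-algebra. -/
  B : Type
  /-- Its C⋆-algebra structure. -/
  [alg : CStarAlgebra B]
  [nontriv : Nontrivial B]
  /-- The first unitary. -/
  u : unitary B
  /-- The second unitary. -/
  v : unitary B
  comm : (u * v : B) = (Circle.exp (4 * Real.pi * α) : ℂ) • (v * u : B)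

attribute [instance] TorusPair.alg TorusPair.nontriv

/-- The bounded families in the product of all `TorusPair`s. -/
abbrev TorusProduct (α : ℝ) : Type 1 := lp (fun i : TorusPair α => i.B) ∞

instance (α : ℝ) : CStarAlgebra (TorusProduct α) where
  toStarModule := inferInstance

/-- A family of unitaries, as an element of the product. -/
def TorusProduct.ofUnitary {α : ℝ} (w : ∀ i : TorusPair α, unitary i.B) :
    unitary (TorusProduct α) :=
  ⟨⟨fun i => (w i : i.B), memℓp_infty ⟨1, by
      rintro _ ⟨i, rfl⟩
      exact (CStarRing.norm_of_mem_unitary (w i).2).le⟩⟩, by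
    constructor <;> ext i
    · exact Unitary.coe_star_mul_self (w i)
    · exact Unitary.coe_mul_star_self (w i)⟩

/-- The closed unital ⋆-subalgebra generated by the two universal unitaries. -/
def torusSubalgebra (α : ℝ) : StarSubalgebra ℂ (TorusProduct α) :=
  (StarAlgebra.adjoin ℂ
    {(TorusProduct.ofUnitary (fun i : TorusPair α => i.u) : TorusProduct α),
     (TorusProduct.ofUnitary (fun i : TorusPair α => i.v) : TorusProduct α)}).topologicalClosure

/-- The noncommutative torus `𝔸_{2α}`: the universal unital C⋆-algebra generated by two
unitaries `U`, `V` with `U V = e^{4πiα} V U`. It is realised as the C⋆-algebra generated by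
the families `(u_i)`, `(v_i)`, where `(B_i, u_i, v_i)` runs over all realisations. -/
def NCTorus (α : ℝ) : Type 1 := torusSubalgebra α

namespace NCTorus

variable (α : ℝ)

instance : CStarAlgebra (NCTorus α) :=
  haveI : IsClosed (torusSubalgebra α : Set (TorusProduct α)) :=
    StarSubalgebra.isClosed_topologicalClosure _
  inferInstanceAs (CStarAlgebra (torusSubalgebra α))

instance : PartialOrder (NCTorus α) := CStarAlgebra.spectralOrder _

instance : StarOrderedRing (NCTorus α) := CStarAlgebra.spectralOrderedRing _

/-- The first generator. -/
def U : unitary (NCTorus α) :=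
  ⟨⟨(TorusProduct.ofUnitary (fun i : TorusPair α => i.u) : TorusProduct α),
      StarSubalgebra.le_topologicalClosure _ (StarAlgebra.subset_adjoin ℂ _ (by simp))⟩,
    Subtype.ext (TorusProduct.ofUnitary (fun i : TorusPair α => i.u)).2.1,
    Subtype.ext (TorusProduct.ofUnitary (fun i : TorusPair α => i.u)).2.2⟩

/-- The second generator. -/
def V : unitary (NCTorus α) :=
  ⟨⟨(TorusProduct.ofUnitary (fun i : TorusPair α => i.v) : TorusProduct α),
      StarSubalgebra.le_topologicalClosure _ (StarAlgebra.subset_adjoin ℂ _ (by simp))⟩,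
    Subtype.ext (TorusProduct.ofUnitary (fun i : TorusPair α => i.v)).2.1,
    Subtype.ext (TorusProduct.ofUnitary (fun i : TorusPair α => i.v)).2.2⟩

theorem U_mul_V : (U α * V α : NCTorus α) =
    (Circle.exp (4 * Real.pi * α) : ℂ) • (V α * U α : NCTorus α) :=
  Subtype.ext (lp.ext (funext fun i => i.comm))

/-- The universal property of the noncommutative torus. -/
theorem existsUnique_hom (i : TorusPair α) :
    ∃! φ : NCTorus α →⋆ₐ[ℂ] i.B, φ (U α) = i.u ∧ φ (V α) = i.v := by
  let ψ : NCTorus α →⋆ₐ[ℂ] i.B :=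
    { toFun := fun x => (x.1 : ∀ i : TorusPair α, i.B) i
      map_one' := rfl
      map_mul' := fun _ _ => rfl
      map_zero' := rfl
      map_add' := fun _ _ => rfl
      commutes' := fun _ => rfl
      map_star' := fun _ => rfl }
  refine ⟨ψ, ⟨rfl, rfl⟩, fun φ hφ => ?_⟩
  have h1 : φ (U α) = ψ (U α) := by rw [hφ.1]; rfl
  have h2 : φ (V α) = ψ (V α) := by rw [hφ.2]; rfl
  refine StarAlgHom.ext_topologicalClosure (S := StarAlgebra.adjoin ℂ
    {(TorusProduct.ofUnitary (fun i : TorusPair α => i.u) : TorusProduct α),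
     (TorusProduct.ofUnitary (fun i : TorusPair α => i.v) : TorusProduct α)})
    (φ := φ) (ψ := ψ)
    (AddMonoidHomClass.continuous_of_bound φ 1 fun x => by
      simpa using NonUnitalStarAlgHom.norm_apply_le φ x)
    (AddMonoidHomClass.continuous_of_bound ψ 1 fun x => by
      simpa using NonUnitalStarAlgHom.norm_apply_le ψ x) ?_
  refine StarAlgHom.ext_adjoin ?_
  rintro ⟨x, hx⟩ (rfl | rfl)
  · exact h1
  · exact h2

/-- The Weyl elements `W(m,n) = e^{-2πiαmn} U^m V^n`. -/
def weyl (a : ℤ × ℤ) : NCTorus α :=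
  (Circle.exp (-(2 * Real.pi * α * a.1 * a.2)) : ℂ) •
    ((U α ^ a.1 * V α ^ a.2 : unitary (NCTorus α)) : NCTorus α)

/-- `W(f) = ∑ f(a) W(a)` for a finitely supported `f` on `ℤ²`. -/
def W (f : ℤ × ℤ →₀ ℂ) : NCTorus α := f.sum fun a c => c • weyl α a

end NCTorus

/-! ### Tomita modular theory of a positive functional -/

section Tomita

variable {H : Type*} [NormedAddCommGroup H] [InnerProductSpace ℂ H] [CompleteSpace H]

/-- `S = J T` is the polar decomposition of the (graph of the) conjugate-linear operator `S`:
`T` is positive self-adjoint, `J` is antiunitary, and `S` and `J T` have the same domain and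
the same values. -/
structure IsPolarDecomposition (S : Set (H × H)) (J : H ≃ₗᵢ⋆[ℂ] H) (T : H →ₗ.[ℂ] H) : Prop where
  isSelfAdjoint : IsSelfAdjoint T
  nonneg : ∀ x : T.domain, 0 ≤ ⟪(x : H), T x⟫_ℂ
  graph_eq : ∀ x y : H, (x, y) ∈ S ↔ ∃ hx : x ∈ T.domain, J (T ⟨x, hx⟩) = y

/-- `Δ = T²`, with the natural domain `{x ∈ dom T | T x ∈ dom T}`. -/
def IsOperatorSquare (Δ T : H →ₗ.[ℂ] H) : Prop :=
  ∀ x y : H, (x, y) ∈ Δ.graph ↔ ∃ z : H, (x, z) ∈ T.graph ∧ (z, y) ∈ T.graph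

variable {A : Type*} [CStarAlgebra A] [PartialOrder A] [StarOrderedRing A]

/-- The cyclic vector `ξ_ω` of the GNS representation of `ω`. -/
def gnsVector (ω : A →ₚ[ℂ] ℂ) : ω.GNS := ((ω.toPreGNS 1 : ω.PreGNS) : ω.GNS)

/-- The graph of the Tomita involution: the closure of
`{(π_ω(a) ξ_ω, π_ω(a⋆) ξ_ω) | a ∈ A}`. -/
def tomitaGraph (ω : A →ₚ[ℂ] ℂ) : Set (ω.GNS × ω.GNS) :=
  closure {p | ∃ a : A,
    p = (ω.gnsStarAlgHom a (gnsVector ω), ω.gnsStarAlgHom (star a) (gnsVector ω))}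

/-- `Δ` and `J` are the Tomita modular operator and conjugation of `ω`: the polar decomposition
of the Tomita involution is `S = J Δ^{1/2}`, where `Δ^{1/2}` is a positive self-adjoint operator
whose square is `Δ`. -/
def IsModularPair (ω : A →ₚ[ℂ] ℂ) (Δ : ω.GNS →ₗ.[ℂ] ω.GNS) (J : ω.GNS ≃ₗᵢ⋆[ℂ] ω.GNS) : Prop :=
  ∃ T : ω.GNS →ₗ.[ℂ] ω.GNS, IsPolarDecomposition (tomitaGraph ω) J T ∧ IsOperatorSquare Δ T

end Tomita

/-! ### The states associated with measures on the circle -/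

instance : MeasurableSpace Circle := borel Circle

instance : BorelSpace Circle := ⟨rfl⟩

/-- `μ_n = μ ∘ R^{-n}`, with `R` the rotation by the angle `2πα`. -/
def rotMeasure (α : ℝ) (μ : Measure Circle) (n : ℤ) : Measure Circle :=
  μ.map fun z => Circle.exp (2 * Real.pi * α * n) * z

/-- The Radon–Nikodym derivative `h_n = dμ_{-n} / dμ_n`. -/
def rotDensity (α : ℝ) (μ : Measure Circle) (n : ℤ) (z : Circle) : ℝ :=
  ((rotMeasure α μ (-n)).rnDeriv (rotMeasure α μ n) z).toReal

/-- The Hilbert space `⨁_n L²(𝕋, μ_n)`. -/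
abbrev rotHilbert (α : ℝ) (μ : Measure Circle) : Type :=
  lp (fun n : ℤ => Lp ℂ 2 (rotMeasure α μ n)) 2

/-- The trigonometric polynomial `z ↦ ∑_m f(m,n) z^m`. -/
def rowTransform (f : ℤ × ℤ →₀ ℂ) (n : ℤ) (z : Circle) : ℂ :=
  ∑' m : ℤ, f (m, n) * ((z ^ m : Circle) : ℂ)

/-- `ω` is the functional `ω_μ` : `ω_μ(W(f)) = ∑_m (∫ z^m dμ) f(m,0)` for all finitely
supported `f`. -/
def IsOmega (α : ℝ) (μ : Measure Circle) (ω : NCTorus α →ₚ[ℂ] ℂ) : Prop :=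
  ∀ f : ℤ × ℤ →₀ ℂ,
    ω (NCTorus.W α f) = ∑' m : ℤ, (∫ z, ((z ^ m : Circle) : ℂ) ∂μ) * f (m, 0)

/-- `Φ` identifies the GNS space of `ω` with `⨁_n L²(𝕋, μ_n)` by sending `π_ω(W(f)) ξ_ω` to the
vector whose `n`-th component is `z ↦ ∑_m f(m,n) z^m`. -/
def IsGNSModel {α : ℝ} (μ : Measure Circle) (ω : NCTorus α →ₚ[ℂ] ℂ)
    (Φ : ω.GNS ≃ₗᵢ[ℂ] rotHilbert α μ) : Prop :=
  ∀ (f : ℤ × ℤ →₀ ℂ) (n : ℤ),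
    Φ (ω.gnsStarAlgHom (NCTorus.W α f) (gnsVector ω)) n =ᵐ[rotMeasure α μ n] rowTransform f n

end

/-! The vectors `z ↦ z ^ m` placed in the `n`-th summand of `⨁ₙ L²(𝕋, μₙ)` have the Gram matrix that
`ω_μ` prescribes for the Weyl elements `W(m, n)`, so the Weyl relations define a representation of
the noncommutative torus for which the function `1` in the summand `n = 0` is a cyclic vector
inducing `ω_μ`. Since `W(m, n)⋆ = W(-m, -n)`, the Tomita involution acts on these vectors as the
reflection `(S x)ₙ = conj(x₋ₙ)`. Writing `conj(x₋ₙ) = hₙ^{1/2} conj(y₋ₙ)` with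
`yₙ = hₙ^{1/2} xₙ` and `h₋ₙ = hₙ⁻¹` exhibits this reflection as `J` after multiplication by
`hₙ^{1/2}`; the trigonometric polynomials are a core of the latter, because a vector orthogonal to
the graph over them is annihilated by `1 + hₙ`. The positive self-adjoint factor of a polar
decomposition is unique since it is determined by its square, which `J` does not affect. -/

noncomputable section

/-! ### Unbounded self-adjoint operators -/

section SelfAdjoint

variable {H : Type*} [NormedAddCommGroup H] [InnerProductSpace ℂ H]

theorem inner_graph_comm_of_isFormalAdjoint {T : H →ₗ.[ℂ] H} (hT : T.IsFormalAdjoint T)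
    {x y a b : H} (h : (x, y) ∈ T.graph) (h' : (a, b) ∈ T.graph) : ⟪b, x⟫_ℂ = ⟪a, y⟫_ℂ := by
  obtain ⟨x, rfl, rfl⟩ := T.mem_graph_iff.1 h
  obtain ⟨a, rfl, rfl⟩ := T.mem_graph_iff.1 h'
  exact hT a x

theorem isFormalAdjoint_of_inner_graph_comm {T : H →ₗ.[ℂ] H}
    (h : ∀ x y a b, (x, y) ∈ T.graph → (a, b) ∈ T.graph → ⟪b, x⟫_ℂ = ⟪a, y⟫_ℂ) :
    T.IsFormalAdjoint T :=
  fun a x => h x (T x) a (T a) (T.mem_graph x) (T.mem_graph a)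

theorem eq_zero_of_inner_self_add_inner_self {x y : H} (h : ⟪x, x⟫_ℂ + ⟪y, y⟫_ℂ = 0) :
    x = 0 ∧ y = 0 := by
  have h' : ‖x‖ ^ 2 + ‖y‖ ^ 2 = 0 := by
    rw [← inner_self_eq_norm_sq (𝕜 := ℂ) x, ← inner_self_eq_norm_sq (𝕜 := ℂ) y, ← map_add, h,
      map_zero]
  have hx : ‖x‖ ^ 2 = 0 := by nlinarith [sq_nonneg ‖x‖, sq_nonneg ‖y‖]
  have hy : ‖y‖ ^ 2 = 0 := by nlinarith [sq_nonneg ‖x‖, sq_nonneg ‖y‖]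
  simpa using And.intro hx hy

/-- In terms of operators: the kernel of `1 + T²` is trivial. -/
theorem eq_zero_of_mem_graph_of_mem_graph_neg {T : H →ₗ.[ℂ] H} (hT : T.IsFormalAdjoint T)
    {x y : H} (hx : (x, y) ∈ T.graph) (hy : (y, -x) ∈ T.graph) : x = 0 ∧ y = 0 := by
  refine eq_zero_of_inner_self_add_inner_self ?_
  rw [← inner_graph_comm_of_isFormalAdjoint hT hx hy, inner_neg_left, add_neg_cancel]

theorem isSelfAdjoint_iff_mem_graph_iff [CompleteSpace H] {T : H →ₗ.[ℂ] H} :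
    IsSelfAdjoint T ↔
      ∀ x y, (x, y) ∈ T.graph ↔ ∀ a b, (a, b) ∈ T.graph → ⟪b, x⟫_ℂ = ⟪a, y⟫_ℂ := by
  have adjoint_graph (hT : Dense (T.domain : Set H)) (x y : H) : (x, y) ∈ T.adjoint.graph ↔
      ∀ a b, (a, b) ∈ T.graph → ⟪b, x⟫_ℂ = ⟪a, y⟫_ℂ := by
    rw [LinearPMap.adjoint_graph_eq_graph_adjoint hT, Submodule.mem_adjoint_iff]
    simp only [sub_eq_zero]
  rw [LinearPMap.isSelfAdjoint_def]
  refine ⟨fun h x y => ?_, fun h => ?_⟩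
  · rw [← adjoint_graph (IsSelfAdjoint.dense_domain h), h]
  · have hdense : Dense (T.domain : Set H) := by
      rw [Submodule.dense_iff_topologicalClosure_eq_top, Submodule.topologicalClosure_eq_top_iff,
        Submodule.eq_bot_iff]
      intro y hy
      refine T.graph_fst_eq_zero_snd ((h 0 y).2 fun a b hab => ?_) rfl
      rw [inner_zero_right, hy a (LinearPMap.mem_domain_of_mem_graph hab)]
    refine LinearPMap.eq_of_eq_graph ?_
    ext ⟨x, y⟩
    rw [adjoint_graph hdense, h]

theorem isFormalAdjoint_self_of_isSelfAdjoint [CompleteSpace H] {T : H →ₗ.[ℂ] H}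
    (hT : IsSelfAdjoint T) : T.IsFormalAdjoint T :=
  isFormalAdjoint_of_inner_graph_comm fun x y a b h =>
    (isSelfAdjoint_iff_mem_graph_iff.1 hT x y).1 h a b

/-- The hypothesis `hsurj` says that `1 + T²` is onto. -/
theorem isSelfAdjoint_of_forall_exists [CompleteSpace H] {T : H →ₗ.[ℂ] H}
    (hT : T.IsFormalAdjoint T)
    (hsurj : ∀ x, ∃ y z, (y, z) ∈ T.graph ∧ (z, x - y) ∈ T.graph) : IsSelfAdjoint T := by
  refine isSelfAdjoint_iff_mem_graph_iff.2 fun x y =>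
    ⟨fun h a b h' => inner_graph_comm_of_isFormalAdjoint hT h h', fun h => ?_⟩
  obtain ⟨r, p, hrp, hpr⟩ := hsurj x
  obtain ⟨r', p', hrp', hpr'⟩ := hsurj y
  -- `(r + p', y - (r' - p))` lies in the graph of `T`; its difference from `(x, y)` is the graph
  -- element `(v, -u)` turned by a right angle.
  have hmem : (r + p', y - (r' - p)) ∈ T.graph := by
    have h1 := T.graph.add_mem hrp hpr'
    rwa [Prod.mk_add_mk, show p + (y - r') = y - (r' - p) by abel] at h1
  have hturn : (r' - p, -(x - (r + p'))) ∈ T.graph := by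
    have h1 := T.graph.sub_mem hrp' hpr
    rwa [Prod.mk_sub_mk, show p' - (x - r) = -(x - (r + p')) by abel] at h1
  have hzero : x - (r + p') = 0 ∧ r' - p = 0 := by
    refine eq_zero_of_inner_self_add_inner_self ?_
    have h1 := h _ _ hturn
    have h2 := inner_graph_comm_of_isFormalAdjoint hT hmem hturn
    have h3 : ⟪-(x - (r + p')), x - (r + p')⟫_ℂ = ⟪r' - p, r' - p⟫_ℂ := by
      rw [inner_sub_right (-(x - (r + p'))), h1, h2, ← inner_sub_right, sub_sub_cancel]
    rw [← h3, inner_neg_left, add_neg_cancel]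
  rwa [hzero.2, sub_zero, ← sub_eq_zero.1 hzero.1] at hmem

/-- `R` and `P` are the bounded operators `(1 + T²)⁻¹` and `T (1 + T²)⁻¹`, through which positive
self-adjoint square roots are compared. -/
structure IsResolventPair (T : H →ₗ.[ℂ] H) (R P : H →L[ℂ] H) : Prop where
  mem_graph : ∀ x, (R x, P x) ∈ T.graph
  mem_graph_sub : ∀ x, (P x, x - R x) ∈ T.graph

theorem exists_isResolventPair [CompleteSpace H] {T : H →ₗ.[ℂ] H} (hT : IsSelfAdjoint T) :
    ∃ R P : H →L[ℂ] H, IsResolventPair T R P := by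
  let e := WithLp.prodContinuousLinearEquiv 2 ℂ H H
  let K : Submodule ℂ (WithLp 2 (H × H)) := T.graph.comap e.toLinearEquiv.toLinearMap
  have hK : IsClosed (K : Set (WithLp 2 (H × H))) := hT.isClosed.preimage e.continuous
  have : CompleteSpace K := hK.completeSpace_coe
  -- `(R x, P x)` is the orthogonal projection of `(x, 0)` onto the graph of `T`.
  let Q : H →L[ℂ] H × H :=
    e.toContinuousLinearMap ∘L K.starProjection ∘L e.symm.toContinuousLinearMap ∘L .inl ℂ H H
  refine ⟨.fst ℂ H H ∘L Q, .snd ℂ H H ∘L Q,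
    fun x => K.starProjection_apply_mem (e.symm (x, 0)), fun x => ?_⟩
  refine (isSelfAdjoint_iff_mem_graph_iff.1 hT _ _).2 fun a b hab => ?_
  have horth := K.sub_starProjection_mem_orthogonal (e.symm (x, 0)) (e.symm (a, b)) hab
  have hsum : ⟪a, x - (Q x).1⟫_ℂ + ⟪b, 0 - (Q x).2⟫_ℂ = 0 := horth
  rw [zero_sub, inner_neg_right, ← sub_eq_add_neg, sub_eq_zero] at hsum
  exact hsum.symm

namespace IsResolventPair

variable {T : H →ₗ.[ℂ] H} {R P : H →L[ℂ] H}

theorem apply_eq_of_mem_graph (h : IsResolventPair T R P) (hT : T.IsFormalAdjoint T) {x y : H}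
    (hxy : (x, y) ∈ T.graph) : R y = P x := by
  have h1 : (P x - R y, x - R x - P y) ∈ T.graph :=
    T.graph.sub_mem (h.mem_graph_sub x) (h.mem_graph y)
  have h2 : (x - R x - P y, -(P x - R y)) ∈ T.graph := by
    have h3 := T.graph.sub_mem (T.graph.sub_mem hxy (h.mem_graph x)) (h.mem_graph_sub y)
    rwa [Prod.mk_sub_mk, Prod.mk_sub_mk, show y - P x - (y - R y) = -(P x - R y) by abel] at h3
  exact (sub_eq_zero.1 (eq_zero_of_mem_graph_of_mem_graph_neg hT h1 h2).1).symm

theorem mem_graph_iff (h : IsResolventPair T R P) (hT : T.IsFormalAdjoint T) {x y : H} :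
    (x, y) ∈ T.graph ↔ R y = P x := by
  refine ⟨h.apply_eq_of_mem_graph hT, fun hxy => ?_⟩
  have hPy : P y = x - R x :=
    T.mem_graph_snd_inj (h.mem_graph y) (h.mem_graph_sub x) hxy
  have h1 := T.graph.add_mem (h.mem_graph x) (h.mem_graph_sub y)
  rwa [Prod.mk_add_mk, hPy, hxy, add_sub_cancel, add_sub_cancel] at h1

theorem mul_self (h : IsResolventPair T R P) (hT : T.IsFormalAdjoint T) : P * P = R - R * R := by
  ext x
  simpa using (h.apply_eq_of_mem_graph hT (h.mem_graph_sub x)).symm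

theorem eq_of_sq_le {T' : H →ₗ.[ℂ] H} {R' P' : H →L[ℂ] H} (h : IsResolventPair T R P)
    (h' : IsResolventPair T' R' P') (hT' : T'.IsFormalAdjoint T')
    (hle : ∀ x y, (∃ z, (x, z) ∈ T.graph ∧ (z, y) ∈ T.graph) →
      ∃ z, (x, z) ∈ T'.graph ∧ (z, y) ∈ T'.graph) : R = R' := by
  ext x
  obtain ⟨z, hz, hz'⟩ := hle _ _ ⟨P x, h.mem_graph x, h.mem_graph_sub x⟩
  have h1 : (R x - R' x, z - P' x) ∈ T'.graph := T'.graph.sub_mem hz (h'.mem_graph x)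
  have h2 : (z - P' x, -(R x - R' x)) ∈ T'.graph := by
    have h3 := T'.graph.sub_mem hz' (h'.mem_graph_sub x)
    rwa [Prod.mk_sub_mk, sub_sub_sub_cancel_left, ← neg_sub (R x)] at h3
  exact sub_eq_zero.1 (eq_zero_of_mem_graph_of_mem_graph_neg hT' h1 h2).1

theorem nonneg [CompleteSpace H] (h : IsResolventPair T R P)
    (h0 : ∀ x : T.domain, 0 ≤ ⟪(x : H), T x⟫_ℂ) : 0 ≤ P := by
  have hgraph : ∀ x y, (x, y) ∈ T.graph → 0 ≤ ⟪x, y⟫_ℂ ∧ 0 ≤ ⟪y, x⟫_ℂ := by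
    intro x y hxy
    obtain ⟨x, rfl, rfl⟩ := T.mem_graph_iff.1 hxy
    exact ⟨h0 x, by rw [← inner_conj_symm]; exact star_nonneg_iff.2 (h0 x)⟩
  rw [ContinuousLinearMap.nonneg_iff_isPositive, ContinuousLinearMap.isPositive_iff_complex]
  intro x
  have hx : 0 ≤ ⟪P x, x⟫_ℂ := by
    have h1 := add_nonneg (hgraph _ _ (h.mem_graph x)).2 (hgraph _ _ (h.mem_graph_sub x)).1
    rwa [← inner_add_right, add_sub_cancel] at h1
  exact ⟨(Complex.eq_re_of_ofReal_le (r := 0) (by simpa using hx)).symm,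
    (Complex.nonneg_iff.1 hx).1⟩

end IsResolventPair

theorem eq_of_sq_le_of_nonneg [CompleteSpace H] {T T' : H →ₗ.[ℂ] H}
    (hT : IsSelfAdjoint T) (hT' : IsSelfAdjoint T')
    (h0 : ∀ x : T.domain, 0 ≤ ⟪(x : H), T x⟫_ℂ) (h0' : ∀ x : T'.domain, 0 ≤ ⟪(x : H), T' x⟫_ℂ)
    (hle : ∀ x y, (∃ z, (x, z) ∈ T.graph ∧ (z, y) ∈ T.graph) →
      ∃ z, (x, z) ∈ T'.graph ∧ (z, y) ∈ T'.graph) : T = T' := by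
  have hs := isFormalAdjoint_self_of_isSelfAdjoint hT
  have hs' := isFormalAdjoint_self_of_isSelfAdjoint hT'
  obtain ⟨R, P, h⟩ := exists_isResolventPair hT
  obtain ⟨R', P', h'⟩ := exists_isResolventPair hT'
  obtain rfl : R = R' := h.eq_of_sq_le h' hs' hle
  obtain rfl : P = P' := by
    rw [← CFC.mul_self_eq_mul_self_iff P P' (h.nonneg h0) (h'.nonneg h0'), h.mul_self hs,
      h'.mul_self hs']
  refine LinearPMap.eq_of_eq_graph ?_
  ext ⟨x, y⟩
  rw [h.mem_graph_iff hs, h'.mem_graph_iff hs']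

/-- A criterion for `S` to contain a core of `T`. -/
theorem graph_le_topologicalClosure_of_forall_inner [CompleteSpace H] {T : H →ₗ.[ℂ] H}
    (hT : T.IsClosed) {S : Submodule ℂ H}
    (h : ∀ x y, (x, y) ∈ T.graph →
      (∀ a b, a ∈ S → (a, b) ∈ T.graph → ⟪a, x⟫_ℂ + ⟪b, y⟫_ℂ = 0) → x = 0) :
    T.graph ≤ (T.domRestrict S).graph.topologicalClosure := by
  let e := WithLp.prodContinuousLinearEquiv 2 ℂ H H
  let G := (T.domRestrict S).graph.topologicalClosure
  let K : Submodule ℂ (WithLp 2 (H × H)) := G.comap e.toLinearEquiv.toLinearMap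
  have hK : IsClosed (K : Set (WithLp 2 (H × H))) :=
    (Submodule.isClosed_topologicalClosure _).preimage e.continuous
  have : CompleteSpace K := hK.completeSpace_coe
  have hGT : G ≤ T.graph := Submodule.topologicalClosure_minimal _
    (LinearPMap.le_graph_of_le LinearPMap.domRestrict_le) hT
  intro p hp
  let q : H × H := e (K.starProjection (e.symm p))
  have hq : q ∈ G := K.starProjection_apply_mem _
  have hpq : (p.1 - q.1, p.2 - q.2) ∈ T.graph := T.graph.sub_mem hp (hGT hq)
  have hfst : p.1 - q.1 = 0 := by
    refine h _ _ hpq fun a b ha hab => ?_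
    have hab' : (a, b) ∈ (T.domRestrict S).graph := by
      obtain ⟨x, rfl, rfl⟩ := T.mem_graph_iff.1 hab
      exact (LinearPMap.mem_graph_iff _).2 ⟨⟨x, ha, x.2⟩, rfl, LinearPMap.domRestrict_apply rfl⟩
    exact K.sub_starProjection_mem_orthogonal (e.symm p) (e.symm (a, b))
      (Submodule.le_topologicalClosure _ hab')
  have hsnd : p.2 - q.2 = 0 := T.graph_fst_eq_zero_snd hpq hfst
  rwa [show p = q from Prod.ext (sub_eq_zero.1 hfst) (sub_eq_zero.1 hsnd)]

end SelfAdjoint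

section PolarDecomposition

variable {H : Type*} [NormedAddCommGroup H] [InnerProductSpace ℂ H]

namespace IsOperatorSquare

variable {Δ Δ' T : H →ₗ.[ℂ] H}

theorem eq (h : IsOperatorSquare Δ T) (h' : IsOperatorSquare Δ' T) : Δ = Δ' :=
  LinearPMap.eq_of_eq_graph (by ext ⟨x, y⟩; rw [h, h'])

theorem nonneg (h : IsOperatorSquare Δ T) (hT : T.IsFormalAdjoint T) (x : Δ.domain) :
    0 ≤ ⟪(x : H), Δ x⟫_ℂ := by
  obtain ⟨z, hxz, hz⟩ := (h x (Δ x)).1 (Δ.mem_graph x)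
  rw [← inner_graph_comm_of_isFormalAdjoint hT hz hxz]
  simp [inner_self_eq_norm_sq_to_K]

end IsOperatorSquare

namespace IsPolarDecomposition

variable [CompleteSpace H] {S : Set (H × H)} {J J' : H ≃ₗᵢ⋆[ℂ] H} {T T' : H →ₗ.[ℂ] H}

theorem mem_iff (h : IsPolarDecomposition S J T) {x y : H} :
    (x, J y) ∈ S ↔ (x, y) ∈ T.graph := by
  rw [h.graph_eq, LinearPMap.mem_graph_iff]
  exact ⟨fun ⟨hx, hy⟩ => ⟨⟨x, hx⟩, rfl, J.injective hy⟩,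
    fun ⟨⟨_, hu⟩, hux, hy⟩ => by cases hux; exact ⟨hu, congrArg J hy⟩⟩

theorem mem_graph_iff (h : IsPolarDecomposition S J T) (h' : IsPolarDecomposition S J' T')
    {x y : H} : (x, y) ∈ T.graph ↔ (x, J'.symm (J y)) ∈ T'.graph := by
  rw [← h.mem_iff, ← h'.mem_iff, J'.apply_symm_apply]

/-- The graphs of `T` and `T'` differ by the unitary `J'⁻¹ J`, so that `T² = T'²`. -/
theorem eq_right (h : IsPolarDecomposition S J T) (h' : IsPolarDecomposition S J' T') :
    T = T' := by
  refine eq_of_sq_le_of_nonneg h.isSelfAdjoint h'.isSelfAdjoint h.nonneg h'.nonneg ?_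
  rintro x y ⟨z, hxz, hzy⟩
  let V : H ≃ₗᵢ[ℂ] H := J.trans J'.symm
  refine ⟨V z, (h.mem_graph_iff h').1 hxz,
    (isSelfAdjoint_iff_mem_graph_iff.1 h'.isSelfAdjoint _ _).2 fun a b hab => ?_⟩
  have hab' : (a, V.symm b) ∈ T.graph := by
    rw [h.mem_graph_iff h']
    simpa [V] using hab
  rw [← (isSelfAdjoint_iff_mem_graph_iff.1 h.isSelfAdjoint _ _).1 hzy _ _ hab',
    ← V.inner_map_map (V.symm b), V.apply_symm_apply]

theorem eq_left (h : IsPolarDecomposition S J T) (h' : IsPolarDecomposition S J' T')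
    (hS : ∀ x, (x, 0) ∈ S → x = 0) : J = J' := by
  obtain rfl : T = T' := h.eq_right h'
  let V : H ≃ₗᵢ[ℂ] H := J.trans J'.symm
  have hV_range : ∀ x y, (x, y) ∈ T.graph → V y = y := fun x y hxy =>
    T.mem_graph_snd_inj ((h.mem_graph_iff h').1 hxy) hxy rfl
  have hV : ∀ w, V.symm w = w := fun w => by
    have hker : (V.symm w - w, (0 : H)) ∈ T.graph := by
      refine (isSelfAdjoint_iff_mem_graph_iff.1 h.isSelfAdjoint _ _).2 fun a b hab => ?_
      rw [inner_zero_right, inner_sub_right, ← V.inner_map_map, hV_range a b hab,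
        V.apply_symm_apply, sub_self]
    rw [← h.mem_iff, map_zero] at hker
    exact sub_eq_zero.1 (hS _ hker)
  ext w
  have h1 : J.symm (J' (J.symm (J w))) = J.symm (J w) := hV (J.symm (J w))
  simpa using (congrArg J h1).symm

end IsPolarDecomposition

variable {G : Type*} [NormedAddCommGroup G] [InnerProductSpace ℂ G]

/-- The operator `Φ⁻¹ T Φ`, which carries the operators of a model space `H` back to `G`. -/
def conjOp (Φ : G ≃ₗᵢ[ℂ] H) (T : H →ₗ.[ℂ] H) : G →ₗ.[ℂ] G :=
  (T.graph.comap (Φ.toLinearEquiv.prodCongr Φ.toLinearEquiv).toLinearMap).toLinearPMap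

theorem mem_graph_conjOp (Φ : G ≃ₗᵢ[ℂ] H) {T : H →ₗ.[ℂ] H} {x y : G} :
    (x, y) ∈ (conjOp Φ T).graph ↔ (Φ x, Φ y) ∈ T.graph := by
  rw [conjOp, Submodule.toLinearPMap_graph_eq]
  · rfl
  · rintro ⟨a, b⟩ hab rfl
    exact (map_eq_zero_iff Φ Φ.injective).1 (T.graph_fst_eq_zero_snd hab (map_zero Φ))

theorem mem_domain_conjOp (Φ : G ≃ₗᵢ[ℂ] H) {T : H →ₗ.[ℂ] H} {x : G} :
    x ∈ (conjOp Φ T).domain ↔ Φ x ∈ T.domain := by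
  simp only [LinearPMap.mem_domain_iff, mem_graph_conjOp, Φ.surjective.exists]

theorem IsOperatorSquare.conj {Δ T : H →ₗ.[ℂ] H} (h : IsOperatorSquare Δ T) (Φ : G ≃ₗᵢ[ℂ] H) :
    IsOperatorSquare (conjOp Φ Δ) (conjOp Φ T) := fun x y => by
  simp only [mem_graph_conjOp, h (Φ x), Φ.surjective.exists]

theorem isSelfAdjoint_conjOp [CompleteSpace G] [CompleteSpace H] {T : H →ₗ.[ℂ] H}
    (hT : IsSelfAdjoint T) (Φ : G ≃ₗᵢ[ℂ] H) : IsSelfAdjoint (conjOp Φ T) := by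
  refine isSelfAdjoint_iff_mem_graph_iff.2 fun x y => ?_
  simp only [mem_graph_conjOp, isSelfAdjoint_iff_mem_graph_iff.1 hT (Φ x), Φ.surjective.forall,
    Φ.inner_map_map]

theorem IsPolarDecomposition.conj [CompleteSpace G] [CompleteSpace H] {S : Set (H × H)}
    {J : H ≃ₗᵢ⋆[ℂ] H} {T : H →ₗ.[ℂ] H} (h : IsPolarDecomposition S J T) (Φ : G ≃ₗᵢ[ℂ] H) :
    IsPolarDecomposition (Prod.map Φ Φ ⁻¹' S) (Φ.trans (J.trans Φ.symm)) (conjOp Φ T) where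
  isSelfAdjoint := isSelfAdjoint_conjOp h.isSelfAdjoint Φ
  nonneg x := by
    obtain ⟨y, hy, hTy⟩ := T.mem_graph_iff.1 ((mem_graph_conjOp Φ).1 ((conjOp Φ T).mem_graph x))
    dsimp only at hy hTy
    rw [← Φ.inner_map_map, ← hTy, ← hy]
    exact h.nonneg y
  graph_eq x y := by
    obtain ⟨y, rfl⟩ := (Φ.trans (J.trans Φ.symm)).surjective y
    have h1 : (x, (Φ.trans (J.trans Φ.symm)) y) ∈ Prod.map Φ Φ ⁻¹' S ↔ (Φ x, J (Φ y)) ∈ S := by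
      simp
    rw [h1, h.mem_iff, ← mem_graph_conjOp, LinearPMap.mem_graph_iff]
    simp

end PolarDecomposition

/-! ### Multiplication operators on Hilbert sums of `L²` spaces -/

section Multiplication

variable {ι X : Type*} [MeasurableSpace X] {ν : ι → Measure X}

section LpTwo

variable {E : Type*} [NormedAddCommGroup E]

theorem ofReal_norm_sq_eq_lintegral {m : Measure X} (f : Lp E 2 m) :
    ENNReal.ofReal (‖f‖ ^ 2) = ∫⁻ z, ‖f z‖ₑ ^ 2 ∂m := by
  rw [ENNReal.ofReal_pow (norm_nonneg _), ofReal_norm, Lp.enorm_def]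
  simpa using eLpNorm_nnreal_pow_eq_lintegral (f := f) (μ := m) (p := 2) two_ne_zero

theorem ofReal_norm_sq_eq_tsum_lintegral (x : lp (fun i => Lp E 2 (ν i)) 2) :
    ENNReal.ofReal (‖x‖ ^ 2) = ∑' i, ∫⁻ z, ‖x i z‖ₑ ^ 2 ∂(ν i) := by
  have h := lp.hasSum_norm (p := 2) (by norm_num) x
  simp only [ENNReal.toReal_ofNat, Real.rpow_ofNat] at h
  rw [← h.tsum_eq, ENNReal.ofReal_tsum_of_nonneg (fun i => by positivity) h.summable]
  simp only [ofReal_norm_sq_eq_lintegral]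

theorem lp_two_ext {x y : lp (fun i => Lp E 2 (ν i)) 2} (h : ∀ i, x i =ᵐ[ν i] y i) : x = y :=
  lp.ext (funext fun i => Lp.ext (h i))

theorem exists_lp_two_iff {f : ι → X → E} (hf : ∀ i, AEStronglyMeasurable (f i) (ν i)) :
    (∃ y : lp (fun i => Lp E 2 (ν i)) 2, ∀ i, y i =ᵐ[ν i] f i) ↔
      ∑' i, ∫⁻ z, ‖f i z‖ₑ ^ 2 ∂(ν i) < ∞ := by
  constructor
  · rintro ⟨y, hy⟩
    have hsum : ∑' i, ∫⁻ z, ‖f i z‖ₑ ^ 2 ∂(ν i) = ∑' i, ∫⁻ z, ‖y i z‖ₑ ^ 2 ∂(ν i) :=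
      tsum_congr fun i => lintegral_congr_ae ((hy i).mono fun z hz => by simp only [hz])
    rw [hsum, ← ofReal_norm_sq_eq_tsum_lintegral]
    exact ENNReal.ofReal_lt_top
  · intro h
    have hmem : ∀ i, MemLp (f i) 2 (ν i) := fun i => by
      refine ⟨hf i, ?_⟩
      rw [eLpNorm_lt_top_iff_lintegral_rpow_enorm_lt_top two_ne_zero ENNReal.ofNat_ne_top]
      simpa using (ENNReal.le_tsum i).trans_lt h
    have hmem' : Memℓp (fun i => (hmem i).toLp (f i)) 2 := by
      rw [memℓp_gen_iff (by norm_num)]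
      have hne : ∑' i, ENNReal.ofReal (‖(hmem i).toLp (f i)‖ ^ 2) ≠ ∞ := by
        simp only [ofReal_norm_sq_eq_lintegral]
        convert h.ne using 3 with i
        exact lintegral_congr_ae ((hmem i).coeFn_toLp.mono fun z hz => by simp only [hz])
      simpa [ENNReal.toReal_ofReal] using ENNReal.summable_toReal hne
    exact ⟨⟨_, hmem'⟩, fun i => (hmem i).coeFn_toLp⟩

theorem exists_lp_two_of_norm_sq_le {f : ι → X → E}
    (hf : ∀ i, AEStronglyMeasurable (f i) (ν i)) (x y : lp (fun i => Lp E 2 (ν i)) 2)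
    (h : ∀ i, ∀ᵐ z ∂(ν i), ‖f i z‖ ^ 2 ≤ ‖x i z‖ ^ 2 + ‖y i z‖ ^ 2) :
    ∃ w : lp (fun i => Lp E 2 (ν i)) 2, ∀ i, w i =ᵐ[ν i] f i := by
  rw [exists_lp_two_iff hf]
  calc ∑' i, ∫⁻ z, ‖f i z‖ₑ ^ 2 ∂(ν i)
      ≤ ∑' i, (∫⁻ z, ‖x i z‖ₑ ^ 2 ∂(ν i) + ∫⁻ z, ‖y i z‖ₑ ^ 2 ∂(ν i)) := by
        refine ENNReal.tsum_le_tsum fun i => ?_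
        rw [← lintegral_add_left' ((Lp.aestronglyMeasurable (x i)).enorm.pow_const 2)]
        refine lintegral_mono_ae ((h i).mono fun z hz => ?_)
        simp only [← ofReal_norm, ← ENNReal.ofReal_pow (norm_nonneg _)]
        rw [← ENNReal.ofReal_add (by positivity) (by positivity)]
        exact ENNReal.ofReal_le_ofReal hz
    _ = ENNReal.ofReal (‖x‖ ^ 2) + ENNReal.ofReal (‖y‖ ^ 2) := by
        rw [ENNReal.tsum_add, ofReal_norm_sq_eq_tsum_lintegral, ofReal_norm_sq_eq_tsum_lintegral]
    _ < ∞ := ENNReal.add_lt_top.2 ⟨ENNReal.ofReal_lt_top, ENNReal.ofReal_lt_top⟩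

end LpTwo

theorem inner_lp_two_congr {x y a b : lp (fun i => Lp ℂ 2 (ν i)) 2}
    (h : ∀ i, ∀ᵐ z ∂(ν i), conj (x i z) * y i z = conj (a i z) * b i z) :
    ⟪x, y⟫_ℂ = ⟪a, b⟫_ℂ := by
  rw [lp.inner_eq_tsum, lp.inner_eq_tsum]
  refine tsum_congr fun i => ?_
  rw [L2.inner_def, L2.inner_def]
  refine integral_congr_ae ((h i).mono fun z hz => ?_)
  simp only [RCLike.inner_apply']
  exact hz

theorem inner_lp_two_eq_integral {i : ι} {a x : lp (fun i => Lp ℂ 2 (ν i)) 2} {f : X → ℂ}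
    (hf : a i =ᵐ[ν i] f) (h0 : ∀ j ≠ i, a j =ᵐ[ν j] 0) :
    ⟪a, x⟫_ℂ = ∫ z, conj (f z) * x i z ∂(ν i) := by
  rw [lp.inner_eq_tsum, tsum_eq_single i fun j hj => by
    rw [(Lp.eq_zero_iff_ae_eq_zero).2 (h0 j hj), inner_zero_left], L2.inner_def]
  refine integral_congr_ae (hf.mono fun z hz => ?_)
  simp only [RCLike.inner_apply', hz]

/-- The graph of `mulOp`. -/
def mulGraph (ν : ι → Measure X) (g : ι → X → ℝ) :
    Submodule ℂ (lp (fun i => Lp ℂ 2 (ν i)) 2 × lp (fun i => Lp ℂ 2 (ν i)) 2) where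
  carrier := {p | ∀ i, p.2 i =ᵐ[ν i] fun z => (g i z : ℂ) * p.1 i z}
  add_mem' {p q} hp hq i := by
    filter_upwards [hp i, hq i, Lp.coeFn_add (p.1 i) (q.1 i), Lp.coeFn_add (p.2 i) (q.2 i)]
      with z h1 h2 h3 h4
    simp only [Prod.snd_add, Prod.fst_add, lp.coeFn_add, Pi.add_apply] at h3 h4 ⊢
    rw [h3, h4, h1, h2, mul_add]
  zero_mem' i := by
    filter_upwards [Lp.coeFn_zero ℂ 2 (ν i)] with z h
    simp only [Prod.snd_zero, Prod.fst_zero, lp.coeFn_zero, Pi.zero_apply] at h ⊢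
    rw [h, mul_zero]
  smul_mem' c p hp i := by
    filter_upwards [hp i, Lp.coeFn_smul c (p.1 i), Lp.coeFn_smul c (p.2 i)] with z h1 h3 h4
    simp only [Prod.smul_snd, Prod.smul_fst, lp.coeFn_smul, Pi.smul_apply, smul_eq_mul] at h3 h4 ⊢
    rw [h3, h4, h1, mul_left_comm]

/-- The operator of multiplication by the family `g` of real functions, with its maximal domain. -/
def mulOp (ν : ι → Measure X) (g : ι → X → ℝ) :
    lp (fun i => Lp ℂ 2 (ν i)) 2 →ₗ.[ℂ] lp (fun i => Lp ℂ 2 (ν i)) 2 :=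
  (mulGraph ν g).toLinearPMap

variable {g h : ι → X → ℝ} {x y : lp (fun i => Lp ℂ 2 (ν i)) 2}

theorem mem_graph_mulOp :
    (x, y) ∈ (mulOp ν g).graph ↔ ∀ i, y i =ᵐ[ν i] fun z => (g i z : ℂ) * x i z := by
  rw [mulOp, Submodule.toLinearPMap_graph_eq]
  · rfl
  · rintro ⟨a, b⟩ hab rfl
    refine lp_two_ext fun i => ?_
    filter_upwards [hab i, Lp.coeFn_zero ℂ 2 (ν i)] with z h1 h2
    simp only [lp.coeFn_zero, Pi.zero_apply] at h1 h2 ⊢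
    rw [h1, h2, mul_zero]

theorem exists_mem_graph_mulOp_of_le (hg : ∀ i, AEMeasurable (g i) (ν i))
    (x y : lp (fun i => Lp ℂ 2 (ν i)) 2)
    (hle : ∀ i, ∀ᵐ z ∂(ν i), ‖(g i z : ℂ) * x i z‖ ^ 2 ≤ ‖x i z‖ ^ 2 + ‖y i z‖ ^ 2) :
    ∃ w, (x, w) ∈ (mulOp ν g).graph := by
  simp only [mem_graph_mulOp]
  exact exists_lp_two_of_norm_sq_le (fun i =>
    (Complex.measurable_ofReal.comp_aemeasurable (hg i)).aestronglyMeasurable.mul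
      (Lp.aestronglyMeasurable (x i))) x y hle

theorem exists_mem_graph_mulOp_of_abs_le_one (hg : ∀ i, AEMeasurable (g i) (ν i))
    (hb : ∀ i z, |g i z| ≤ 1) (x : lp (fun i => Lp ℂ 2 (ν i)) 2) :
    ∃ w, (x, w) ∈ (mulOp ν g).graph := by
  refine exists_mem_graph_mulOp_of_le hg x x fun i => .of_forall fun z => ?_
  have h1 : g i z ^ 2 ≤ 1 := (sq_le_one_iff_abs_le_one _).2 (hb i z)
  rw [norm_mul, Complex.norm_real, mul_pow, Real.norm_eq_abs, sq_abs]
  nlinarith [sq_nonneg ‖x i z‖]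

theorem mem_domain_mulOp_iff (hg : ∀ i, AEMeasurable (g i) (ν i)) :
    x ∈ (mulOp ν g).domain ↔ ∑' i, ∫⁻ z, ‖(g i z : ℂ) * x i z‖ₑ ^ 2 ∂(ν i) < ∞ := by
  simp only [LinearPMap.mem_domain_iff, mem_graph_mulOp]
  exact exists_lp_two_iff fun i =>
    (Complex.measurable_ofReal.comp_aemeasurable (hg i)).aestronglyMeasurable.mul
      (Lp.aestronglyMeasurable (x i))

theorem isFormalAdjoint_mulOp : (mulOp ν g).IsFormalAdjoint (mulOp ν g) := by
  refine isFormalAdjoint_of_inner_graph_comm fun x y a b h h' => inner_lp_two_congr fun i => ?_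
  filter_upwards [mem_graph_mulOp.1 h i, mem_graph_mulOp.1 h' i] with z h1 h2
  rw [h1, h2, map_mul, Complex.conj_ofReal]
  ring

theorem isSelfAdjoint_mulOp (hg : ∀ i, AEMeasurable (g i) (ν i)) : IsSelfAdjoint (mulOp ν g) := by
  refine isSelfAdjoint_of_forall_exists isFormalAdjoint_mulOp fun x => ?_
  have hpos : ∀ i z, 0 < 1 + g i z ^ 2 := fun i z => by positivity
  have hsq : ∀ i, AEMeasurable (fun z => 1 + g i z ^ 2) (ν i) := fun i =>
    ((hg i).pow_const 2).const_add 1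
  obtain ⟨y, hy⟩ := exists_mem_graph_mulOp_of_abs_le_one (g := fun i z => 1 / (1 + g i z ^ 2))
    (fun i => (hsq i).const_div 1) (fun i z => by
      rw [abs_of_nonneg (by positivity), div_le_one (hpos i z)]
      nlinarith [sq_nonneg (g i z)]) x
  obtain ⟨w, hw⟩ := exists_mem_graph_mulOp_of_abs_le_one (g := fun i z => g i z / (1 + g i z ^ 2))
    (fun i => (hg i).div (hsq i)) (fun i z => by
      rw [abs_div, abs_of_pos (hpos i z), div_le_one (hpos i z)]
      nlinarith [sq_abs (g i z), sq_nonneg (|g i z| - 1), abs_nonneg (g i z)]) x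
  rw [mem_graph_mulOp] at hy hw
  refine ⟨y, w, mem_graph_mulOp.2 fun i => ?_, mem_graph_mulOp.2 fun i => ?_⟩
  · filter_upwards [hy i, hw i] with z h1 h2
    rw [h1, h2]
    push_cast
    ring
  · filter_upwards [hy i, hw i, Lp.coeFn_sub (x i) (y i)] with z h1 h2 h3
    have hne : (1 + (g i z : ℂ) ^ 2) ≠ 0 := by exact_mod_cast (hpos i z).ne'
    simp only [lp.coeFn_sub, Pi.sub_apply] at h3 ⊢
    rw [h3, h1, h2]
    push_cast
    field_simp
    ring

theorem isOperatorSquare_mulOp_sqrt (hh : ∀ i, AEMeasurable (h i) (ν i)) (h0 : ∀ i z, 0 ≤ h i z) :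
    IsOperatorSquare (mulOp ν h) (mulOp ν fun i z => √(h i z)) := by
  have hmul_self : ∀ i z, ((√(h i z) : ℝ) : ℂ) * (√(h i z) : ℝ) = h i z := fun i z => by
    rw [← Complex.ofReal_mul, Real.mul_self_sqrt (h0 i z)]
  intro x y
  refine ⟨fun hxy => ?_, fun ⟨w, hw, hy⟩ => mem_graph_mulOp.2 fun i => ?_⟩
  · rw [mem_graph_mulOp] at hxy
    obtain ⟨w, hw⟩ := exists_mem_graph_mulOp_of_le (g := fun i z => √(h i z))
      (fun i => (hh i).sqrt) x y fun i => by
        filter_upwards [hxy i] with z hz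
        rw [hz, norm_mul, norm_mul, Complex.norm_real, Complex.norm_real, mul_pow, mul_pow,
          Real.norm_eq_abs, Real.norm_eq_abs, sq_abs, sq_abs, Real.sq_sqrt (h0 i z), ← one_add_mul]
        exact mul_le_mul_of_nonneg_right (by nlinarith [sq_nonneg (h i z - 1), h0 i z])
          (sq_nonneg _)
    refine ⟨w, hw, mem_graph_mulOp.2 fun i => ?_⟩
    filter_upwards [hxy i, mem_graph_mulOp.1 hw i] with z h1 h2
    rw [h1, h2, ← mul_assoc, hmul_self]
  · filter_upwards [mem_graph_mulOp.1 hw i, mem_graph_mulOp.1 hy i] with z h1 h2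
    rw [h2, h1, ← mul_assoc, hmul_self]

theorem inner_mulOp_nonneg (hh : ∀ i, AEMeasurable (h i) (ν i)) (h0 : ∀ i z, 0 ≤ h i z)
    (x : (mulOp ν h).domain) : 0 ≤ ⟪(x : lp (fun i => Lp ℂ 2 (ν i)) 2), mulOp ν h x⟫_ℂ :=
  (isOperatorSquare_mulOp_sqrt hh h0).nonneg isFormalAdjoint_mulOp x

end Multiplication

/-! ### Reflected families of measures -/

section Reflection

variable {ι X : Type*} [MeasurableSpace X] [InvolutiveNeg ι]

/-- The Radon–Nikodym derivatives `dν₋ᵢ / dνᵢ`; for the rotated measures they are the `h_n`. -/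
def negDensity (ν : ι → Measure X) (i : ι) (z : X) : ℝ := ((ν (-i)).rnDeriv (ν i) z).toReal

variable {ν : ι → Measure X}

theorem measurable_negDensity (i : ι) : Measurable (negDensity ν i) :=
  (Measure.measurable_rnDeriv _ _).ennreal_toReal

theorem negDensity_nonneg (i : ι) (z : X) : 0 ≤ negDensity ν i z := ENNReal.toReal_nonneg

theorem absolutelyContinuous_neg (hν : ∀ i, ν (-i) ≪ ν i) (i : ι) : ν i ≪ ν (-i) := by
  simpa only [neg_neg] using hν (-i)

theorem memLp_sqrt_negDensity {i : ι} [IsFiniteMeasure (ν (-i))] :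
    MemLp (fun z => √(negDensity ν i z)) 2 (ν i) := by
  have hm : Measurable fun z => √(negDensity ν i z) := (measurable_negDensity i).sqrt
  refine (memLp_two_iff_integrable_sq hm.aestronglyMeasurable).2 ?_
  simp only [Real.sq_sqrt (negDensity_nonneg i _)]
  exact Measure.integrable_toReal_rnDeriv

/-- The graph of the conjugate-linear involution `(S x)ᵢ = conj(x₋ᵢ)`. -/
def reflectionGraph (ν : ι → Measure X) :
    Set (lp (fun i => Lp ℂ 2 (ν i)) 2 × lp (fun i => Lp ℂ 2 (ν i)) 2) :=
  {p | ∀ i, p.2 i =ᵐ[ν i] fun z => conj (p.1 (-i) z)}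

theorem eq_zero_of_mk_zero_mem_reflectionGraph (hν : ∀ i, ν (-i) ≪ ν i)
    {x : lp (fun i => Lp ℂ 2 (ν i)) 2} (h : (x, 0) ∈ reflectionGraph ν) : x = 0 :=
  lp_two_ext fun i => by
    have hS := h (-i)
    rw [neg_neg] at hS
    filter_upwards [(absolutelyContinuous_neg hν i).ae_le hS, Lp.coeFn_zero ℂ 2 (ν i),
      (absolutelyContinuous_neg hν i).ae_le (Lp.coeFn_zero ℂ 2 (ν (-i)))] with z h1 h2 h3
    simp only [lp.coeFn_zero, Pi.zero_apply] at h1 h2 h3 ⊢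
    rw [h2]
    exact (map_eq_zero (starRingEnd ℂ)).1 (h1.symm.trans h3)

variable [∀ i, SigmaFinite (ν i)]

theorem negDensity_mul_negDensity_neg (hν : ∀ i, ν (-i) ≪ ν i) (i : ι) :
    ∀ᵐ z ∂(ν i), negDensity ν i z * negDensity ν (-i) z = 1 := by
  have hac := absolutelyContinuous_neg hν i
  filter_upwards [Measure.inv_rnDeriv hac, hac.ae_le (Measure.rnDeriv_lt_top (ν i) (ν (-i))),
    Measure.rnDeriv_pos hac] with z hinv hfin hpos
  simp only [negDensity, neg_neg, Pi.inv_apply] at hinv ⊢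
  rw [← hinv, ENNReal.toReal_inv]
  exact inv_mul_cancel₀ (ENNReal.toReal_pos hpos.ne' hfin.ne).ne'

theorem sqrt_negDensity_mul_sqrt_negDensity_neg (hν : ∀ i, ν (-i) ≪ ν i) (i : ι) :
    ∀ᵐ z ∂(ν i), (√(negDensity ν i z) : ℂ) * √(negDensity ν (-i) z) = 1 := by
  filter_upwards [negDensity_mul_negDensity_neg hν i] with z hz
  rw [← Complex.ofReal_mul, ← Real.sqrt_mul (negDensity_nonneg i z), hz, Real.sqrt_one,
    Complex.ofReal_one]

theorem lintegral_negDensity_mul {i : ι} (hi : ν (-i) ≪ ν i) {f : X → ℝ≥0∞}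
    (hf : AEMeasurable f (ν i)) :
    ∫⁻ z, ENNReal.ofReal (negDensity ν i z) * f z ∂(ν i) = ∫⁻ z, f z ∂(ν (-i)) := by
  rw [← lintegral_rnDeriv_mul hi hf]
  refine lintegral_congr_ae ?_
  filter_upwards [Measure.rnDeriv_lt_top (ν (-i)) (ν i)] with z hz
  rw [negDensity, ENNReal.ofReal_toReal hz.ne]

theorem lintegral_enorm_sqrt_negDensity_mul_conj {i : ι} (hi : ν (-i) ≪ ν i) {f : X → ℂ}
    (hf : Measurable f) :
    ∫⁻ z, ‖(√(negDensity ν i z) : ℂ) * conj (f z)‖ₑ ^ 2 ∂(ν i) = ∫⁻ z, ‖f z‖ₑ ^ 2 ∂(ν (-i)) := by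
  rw [← lintegral_negDensity_mul hi (hf.enorm.pow_const 2).aemeasurable]
  refine lintegral_congr fun z => ?_
  rw [enorm_mul, mul_pow, ← ofReal_norm, Complex.norm_real, Real.norm_eq_abs,
    ← ENNReal.ofReal_pow (abs_nonneg _), sq_abs, Real.sq_sqrt (negDensity_nonneg i z),
    RCLike.enorm_conj]

theorem tsum_lintegral_sqrt_negDensity_mul_conj (hν : ∀ i, ν (-i) ≪ ν i)
    (x : lp (fun i => Lp ℂ 2 (ν i)) 2) :
    ∑' i, ∫⁻ z, ‖(√(negDensity ν i z) : ℂ) * conj (x (-i) z)‖ₑ ^ 2 ∂(ν i) =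
      ENNReal.ofReal (‖x‖ ^ 2) := by
  rw [ofReal_norm_sq_eq_tsum_lintegral, ← (Equiv.neg ι).tsum_eq fun i => ∫⁻ z, ‖x i z‖ₑ ^ 2 ∂(ν i)]
  exact tsum_congr fun i =>
    lintegral_enorm_sqrt_negDensity_mul_conj (hν i) (Lp.stronglyMeasurable (x (-i))).measurable

theorem exists_modularConj (hν : ∀ i, ν (-i) ≪ ν i) (x : lp (fun i => Lp ℂ 2 (ν i)) 2) :
    ∃ y : lp (fun i => Lp ℂ 2 (ν i)) 2,
      ∀ i, y i =ᵐ[ν i] fun z => (√(negDensity ν i z) : ℂ) * conj (x (-i) z) := by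
  refine (exists_lp_two_iff fun i => ?_).2 ?_
  · exact ((Complex.measurable_ofReal.comp (measurable_negDensity i).sqrt).mul
      (Complex.continuous_conj.measurable.comp
        (Lp.stronglyMeasurable (x (-i))).measurable)).aestronglyMeasurable
  · rw [tsum_lintegral_sqrt_negDensity_mul_conj hν]
    exact ENNReal.ofReal_lt_top

/-- `modularConj` as a conjugate-linear map. -/
def modularConjLinearMap (hν : ∀ i, ν (-i) ≪ ν i) :
    lp (fun i => Lp ℂ 2 (ν i)) 2 →ₗ⋆[ℂ] lp (fun i => Lp ℂ 2 (ν i)) 2 where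
  toFun x := (exists_modularConj hν x).choose
  map_add' x y := lp_two_ext fun i => by
    have hspec (x : lp (fun i => Lp ℂ 2 (ν i)) 2) := (exists_modularConj hν x).choose_spec i
    filter_upwards [hspec (x + y), hspec x, hspec y,
      Lp.coeFn_add ((exists_modularConj hν x).choose i) ((exists_modularConj hν y).choose i),
      (absolutelyContinuous_neg hν i).ae_le (Lp.coeFn_add (x (-i)) (y (-i)))] with z h1 h2 h3 h4 h5
    simp only [lp.coeFn_add, Pi.add_apply] at h1 h4 h5 ⊢
    rw [h1, h4, h5, h2, h3, map_add, mul_add]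
  map_smul' c x := lp_two_ext fun i => by
    have hspec (x : lp (fun i => Lp ℂ 2 (ν i)) 2) := (exists_modularConj hν x).choose_spec i
    filter_upwards [hspec (c • x), hspec x,
      Lp.coeFn_smul (conj c) ((exists_modularConj hν x).choose i),
      (absolutelyContinuous_neg hν i).ae_le (Lp.coeFn_smul c (x (-i)))] with z h1 h2 h3 h4
    simp only [lp.coeFn_smul, Pi.smul_apply, smul_eq_mul] at h1 h3 h4 ⊢
    rw [h1, h3, h4, h2, map_mul, mul_left_comm]

theorem modularConjLinearMap_ae (hν : ∀ i, ν (-i) ≪ ν i) (x : lp (fun i => Lp ℂ 2 (ν i)) 2)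
    (i : ι) :
    modularConjLinearMap hν x i =ᵐ[ν i] fun z => (√(negDensity ν i z) : ℂ) * conj (x (-i) z) :=
  (exists_modularConj hν x).choose_spec i

theorem involutive_modularConjLinearMap (hν : ∀ i, ν (-i) ≪ ν i) :
    Function.Involutive (modularConjLinearMap hν) := fun x => lp_two_ext fun i => by
  have hneg := modularConjLinearMap_ae hν x (-i)
  rw [neg_neg] at hneg
  filter_upwards [modularConjLinearMap_ae hν (modularConjLinearMap hν x) i,
    (absolutelyContinuous_neg hν i).ae_le hneg,
    sqrt_negDensity_mul_sqrt_negDensity_neg hν i] with z h1 h2 h3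
  rw [h1, h2, map_mul, Complex.conj_ofReal, Complex.conj_conj, ← mul_assoc, h3, one_mul]

theorem norm_modularConjLinearMap (hν : ∀ i, ν (-i) ≪ ν i) (x : lp (fun i => Lp ℂ 2 (ν i)) 2) :
    ‖modularConjLinearMap hν x‖ = ‖x‖ := by
  have h : ENNReal.ofReal (‖modularConjLinearMap hν x‖ ^ 2) = ENNReal.ofReal (‖x‖ ^ 2) := by
    rw [← tsum_lintegral_sqrt_negDensity_mul_conj hν x, ofReal_norm_sq_eq_tsum_lintegral]
    exact tsum_congr fun i => lintegral_congr_ae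
      ((modularConjLinearMap_ae hν x i).mono fun z hz => by simp only [hz])
  rwa [ENNReal.ofReal_eq_ofReal_iff (by positivity) (by positivity),
    sq_eq_sq₀ (norm_nonneg _) (norm_nonneg _)] at h

/-- The antiunitary `(J x)ᵢ = hᵢ^{1/2} conj(x₋ᵢ)` with `hᵢ = dν₋ᵢ / dνᵢ`. -/
def modularConj (hν : ∀ i, ν (-i) ≪ ν i) :
    lp (fun i => Lp ℂ 2 (ν i)) 2 ≃ₗᵢ⋆[ℂ] lp (fun i => Lp ℂ 2 (ν i)) 2 where
  toLinearEquiv := .ofInvolutive (modularConjLinearMap hν) (involutive_modularConjLinearMap hν)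
  norm_map' := norm_modularConjLinearMap hν

theorem modularConj_ae (hν : ∀ i, ν (-i) ≪ ν i) (x : lp (fun i => Lp ℂ 2 (ν i)) 2) (i : ι) :
    modularConj hν x i =ᵐ[ν i] fun z => (√(negDensity ν i z) : ℂ) * conj (x (-i) z) :=
  modularConjLinearMap_ae hν x i

theorem mk_modularConj_mem_reflectionGraph (hν : ∀ i, ν (-i) ≪ ν i)
    {x y : lp (fun i => Lp ℂ 2 (ν i)) 2} :
    (x, modularConj hν y) ∈ reflectionGraph ν ↔
      (x, y) ∈ (mulOp ν fun i z => √(negDensity ν i z)).graph := by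
  rw [mem_graph_mulOp]
  constructor <;> intro h i
  · have hJ := modularConj_ae hν y (-i)
    have hS := h (-i)
    rw [neg_neg] at hJ hS
    filter_upwards [(absolutelyContinuous_neg hν i).ae_le hJ,
      (absolutelyContinuous_neg hν i).ae_le hS,
      sqrt_negDensity_mul_sqrt_negDensity_neg hν i] with z h1 h2 h3
    have h4 := congrArg conj (h1.symm.trans h2)
    rw [map_mul, Complex.conj_ofReal, Complex.conj_conj, Complex.conj_conj] at h4
    rw [← h4, ← mul_assoc, h3, one_mul]
  · filter_upwards [modularConj_ae hν y i, (absolutelyContinuous_neg hν i).ae_le (h (-i)),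
      sqrt_negDensity_mul_sqrt_negDensity_neg hν i] with z h1 h2 h3
    rw [h1, h2, map_mul, Complex.conj_ofReal, ← mul_assoc, h3, one_mul]

theorem isPolarDecomposition_reflectionGraph (hν : ∀ i, ν (-i) ≪ ν i) :
    IsPolarDecomposition (reflectionGraph ν) (modularConj hν)
      (mulOp ν fun i z => √(negDensity ν i z)) where
  isSelfAdjoint := isSelfAdjoint_mulOp fun i => (measurable_negDensity i).sqrt.aemeasurable
  nonneg := inner_mulOp_nonneg (fun i => (measurable_negDensity i).sqrt.aemeasurable)
    fun _ _ => Real.sqrt_nonneg _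
  graph_eq x y := by
    obtain ⟨y, rfl⟩ := (modularConj hν).surjective y
    rw [mk_modularConj_mem_reflectionGraph, LinearPMap.mem_graph_iff]
    simp

end Reflection

/-! ### Trigonometric polynomials -/

section Trigonometric

/-- The function `z ↦ z ^ m` on the circle. -/
def circlePow (m : ℤ) : C(Circle, ℂ) where
  toFun z := ((z ^ m : Circle) : ℂ)
  continuous_toFun := continuous_induced_dom.comp (continuous_zpow m)

theorem circlePow_apply (m : ℤ) (z : Circle) : circlePow m z = ((z ^ m : Circle) : ℂ) := rfl

theorem circlePow_add (m n : ℤ) (z : Circle) :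
    circlePow (m + n) z = circlePow m z * circlePow n z := by
  simp only [circlePow_apply, zpow_add, Circle.coe_mul]

theorem norm_circlePow (m : ℤ) (z : Circle) : ‖circlePow m z‖ = 1 := Circle.norm_coe _

theorem conj_circlePow (m : ℤ) (z : Circle) : conj (circlePow m z) = circlePow (-m) z := by
  rw [circlePow_apply, circlePow_apply, zpow_neg, Circle.coe_inv_eq_conj]

theorem span_circlePow_closure_eq_top :
    (Submodule.span ℂ (Set.range circlePow)).topologicalClosure = ⊤ := by
  let e : AddCircle (1 : ℝ) ≃ₜ Circle := AddCircle.homeomorphCircle one_ne_zero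
  let pullback : C(AddCircle (1 : ℝ), ℂ) →L[ℂ] C(Circle, ℂ) :=
    ContinuousMap.compCLM ℂ ℂ (e.symm : C(Circle, AddCircle (1 : ℝ)))
  have hsurj : Function.Surjective pullback := fun f =>
    ⟨f.comp (e : C(AddCircle (1 : ℝ), Circle)),
      ContinuousMap.ext fun z => congrArg f (e.apply_symm_apply z)⟩
  have hpow : ⇑pullback ∘ fourier = circlePow := funext fun m => ContinuousMap.ext fun z => by
    change ((AddCircle.toCircle (m • e.symm z) : Circle) : ℂ) = ((z ^ m : Circle) : ℂ)
    rw [AddCircle.toCircle_zsmul, ← AddCircle.homeomorphCircle_apply one_ne_zero,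
      e.apply_symm_apply]
  have h := hsurj.denseRange.topologicalClosure_map_submodule
    (span_fourier_closure_eq_top (T := (1 : ℝ)))
  rwa [Submodule.map_span, ← Set.range_comp, ContinuousLinearMap.coe_coe, hpow] at h

variable {ρ : Measure Circle}

theorem integral_mul_eq_zero_of_integral_circlePow_mul {u : Circle → ℂ} (hu : Integrable u ρ)
    (h : ∀ m, ∫ z, circlePow m z * u z ∂ρ = 0) (f : C(Circle, ℂ)) : ∫ z, f z * u z ∂ρ = 0 := by
  have hint (f : C(Circle, ℂ)) : Integrable (fun z => f z * u z) ρ :=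
    hu.bdd_mul (c := ‖f‖) f.continuous.aestronglyMeasurable (.of_forall f.norm_coe_le_norm)
  let L : C(Circle, ℂ) →L[ℂ] ℂ := LinearMap.mkContinuous
    { toFun := fun f => ∫ z, f z * u z ∂ρ
      map_add' := fun f g => by
        simp only [ContinuousMap.add_apply, add_mul, integral_add (hint f) (hint g)]
      map_smul' := fun c f => by
        simp only [ContinuousMap.smul_apply, smul_eq_mul, mul_assoc, integral_const_mul,
          RingHom.id_apply] }
    (∫ z, ‖u z‖ ∂ρ) fun f => by
      rw [mul_comm, ← integral_const_mul]
      refine norm_integral_le_of_norm_le (hu.norm.const_mul _) (.of_forall fun z => ?_)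
      rw [norm_mul]
      gcongr
      exact f.norm_coe_le_norm z
  have hL : L = 0 := ContinuousLinearMap.ext_on
    (Submodule.dense_iff_topologicalClosure_eq_top.2 span_circlePow_closure_eq_top) <| by
      rintro _ ⟨m, rfl⟩
      exact h m
  exact congrArg (fun M : C(Circle, ℂ) →L[ℂ] ℂ => M f) hL

open scoped Manifold in
theorem ae_eq_zero_of_integral_circlePow_mul {u : Circle → ℂ} (hu : Integrable u ρ)
    (h : ∀ m, ∫ z, circlePow m z * u z ∂ρ = 0) : u =ᵐ[ρ] 0 :=
  ae_eq_zero_of_integral_contMDiff_smul_eq_zero (𝓡 1) hu.locallyIntegrable fun g hg _ =>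
    integral_mul_eq_zero_of_integral_circlePow_mul hu h
      ⟨fun z => (g z : ℂ), Complex.continuous_ofReal.comp hg.continuous⟩

variable {ι : Type*} [DecidableEq ι] (ν : ι → Measure Circle) [∀ i, IsFiniteMeasure (ν i)]

/-- The vector of `⨁ᵢ L²(𝕋, νᵢ)` whose only nonzero component, in position `a.2`, is
`z ↦ z ^ a.1`. -/
def trigVec (a : ℤ × ι) : lp (fun i => Lp ℂ 2 (ν i)) 2 :=
  lp.single 2 a.2 (ContinuousMap.toLp 2 (ν a.2) ℂ (circlePow a.1))

variable {ν}

theorem trigVec_ae (a : ℤ × ι) (i : ι) :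
    trigVec ν a i =ᵐ[ν i] fun z => if i = a.2 then circlePow a.1 z else 0 := by
  by_cases h : i = a.2
  · subst h
    simp only [trigVec, lp.single_apply_self, if_true]
    exact ContinuousMap.coeFn_toLp _ _
  · simp only [trigVec, lp.single_apply_ne _ _ _ h, h, if_false]
    exact Lp.coeFn_zero _ _ _

theorem inner_trigVec (a : ℤ × ι) (x : lp (fun i => Lp ℂ 2 (ν i)) 2) :
    ⟪trigVec ν a, x⟫_ℂ = ∫ z, circlePow (-a.1) z * x a.2 z ∂(ν a.2) := by
  rw [inner_lp_two_eq_integral (f := circlePow a.1)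
    ((trigVec_ae a a.2).mono fun z hz => by simp only [hz, if_true])
    fun j hj => (trigVec_ae a j).mono fun z hz => by simp only [hz, hj, if_false, Pi.zero_apply]]
  simp only [conj_circlePow]

theorem inner_trigVec_trigVec (a b : ℤ × ι) : ⟪trigVec ν a, trigVec ν b⟫_ℂ =
    if a.2 = b.2 then ∫ z, circlePow (b.1 - a.1) z ∂(ν a.2) else 0 := by
  have h1 : ⟪trigVec ν a, trigVec ν b⟫_ℂ =
      ∫ z, circlePow (-a.1) z * (if a.2 = b.2 then circlePow b.1 z else 0) ∂(ν a.2) := by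
    rw [inner_trigVec]
    exact integral_congr_ae ((trigVec_ae b a.2).mono fun z hz => by simp only [hz])
  rw [h1]
  split_ifs
  · simp only [← circlePow_add, neg_add_eq_sub]
  · simp only [mul_zero, integral_zero]

theorem span_trigVec_closure_eq_top :
    (Submodule.span ℂ (Set.range (trigVec ν))).topologicalClosure = ⊤ := by
  rw [Submodule.topologicalClosure_eq_top_iff, Submodule.eq_bot_iff]
  intro x hx
  refine lp_two_ext fun i => (ae_eq_zero_of_integral_circlePow_mul
    ((Lp.memLp (x i)).integrable one_le_two) fun m => ?_).trans (Lp.coeFn_zero ℂ 2 (ν i)).symm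
  rw [← neg_neg m, ← inner_trigVec (-m, i)]
  exact hx _ (Submodule.subset_span ⟨(-m, i), rfl⟩)

variable {g : ι → Circle → ℝ}

theorem exists_mem_graph_mulOp_trigVec {a : ℤ × ι} (hg : MemLp (g a.2) 2 (ν a.2)) :
    ∃ w, (trigVec ν a, w) ∈ (mulOp ν g).graph := by
  have hmem : MemLp (fun z => (g a.2 z : ℂ) * circlePow a.1 z) 2 (ν a.2) :=
    hg.of_le (hg.ofReal.1.mul (circlePow a.1).continuous.aestronglyMeasurable)
      (.of_forall fun z => by rw [norm_mul, norm_circlePow, mul_one, Complex.norm_real])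
  refine ⟨lp.single 2 a.2 (hmem.toLp _), mem_graph_mulOp.2 fun i => ?_⟩
  by_cases h : i = a.2
  · subst h
    filter_upwards [trigVec_ae a a.2, hmem.coeFn_toLp] with z h1 h2
    rw [lp.single_apply_self, h1, h2, if_pos rfl]
  · filter_upwards [trigVec_ae a i, Lp.coeFn_zero ℂ 2 (ν i)] with z h1 h2
    rw [lp.single_apply_ne _ _ _ h, h1, h2, if_neg h, Pi.zero_apply, mul_zero]

theorem inner_of_mem_graph_mulOp_trigVec {a : ℤ × ι} {w y : lp (fun i => Lp ℂ 2 (ν i)) 2}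
    (hw : (trigVec ν a, w) ∈ (mulOp ν g).graph) :
    ⟪w, y⟫_ℂ = ∫ z, circlePow (-a.1) z * (g a.2 z * y a.2 z) ∂(ν a.2) := by
  rw [mem_graph_mulOp] at hw
  rw [inner_lp_two_eq_integral (i := a.2) (f := fun z => (g a.2 z : ℂ) * circlePow a.1 z)]
  · simp only [map_mul, Complex.conj_ofReal, conj_circlePow, mul_left_comm, mul_assoc]
  · filter_upwards [hw a.2, trigVec_ae a a.2] with z h1 h2
    rw [h1, h2, if_pos rfl]
  · intro j hj
    filter_upwards [hw j, trigVec_ae a j] with z h1 h2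
    rw [h1, h2, if_neg hj, mul_zero, Pi.zero_apply]

theorem graph_mulOp_le_closure_span_trigVec (hg : ∀ i, MemLp (g i) 2 (ν i)) :
    (mulOp ν g).graph ≤ ((mulOp ν g).domRestrict
      (Submodule.span ℂ (Set.range (trigVec ν)))).graph.topologicalClosure := by
  refine graph_le_topologicalClosure_of_forall_inner
    (isSelfAdjoint_mulOp fun i => (hg i).aemeasurable).isClosed fun x y hxy horth => ?_
  refine lp_two_ext fun i => ?_
  have hx : Integrable (x i) (ν i) := (Lp.memLp (x i)).integrable one_le_two
  have hy : Integrable (fun z => (g i z : ℂ) * y i z) (ν i) :=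
    (hg i).ofReal.integrable_mul (Lp.memLp (y i))
  have hint {u : Circle → ℂ} (hu : Integrable u (ν i)) (m : ℤ) :
      Integrable (fun z => circlePow m z * u z) (ν i) :=
    hu.bdd_mul (c := 1) (circlePow m).continuous.aestronglyMeasurable
      (.of_forall fun z => (norm_circlePow m z).le)
  have hzero := ae_eq_zero_of_integral_circlePow_mul (hx.add hy) fun m => by
    obtain ⟨w, hw⟩ := exists_mem_graph_mulOp_trigVec (a := (-m, i)) (hg i)
    have h := horth _ w (Submodule.subset_span ⟨(-m, i), rfl⟩) hw
    rw [inner_trigVec, inner_of_mem_graph_mulOp_trigVec hw, neg_neg,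
      ← integral_add (hint hx m) (hint hy m)] at h
    simpa only [Pi.add_apply, mul_add] using h
  filter_upwards [hzero, mem_graph_mulOp.1 hxy i, Lp.coeFn_zero ℂ 2 (ν i)] with z h1 h2 h3
  have hne : (1 + (g i z : ℂ) ^ 2) ≠ 0 := by
    exact_mod_cast (by positivity : (0 : ℝ) < 1 + g i z ^ 2).ne'
  simp only [Pi.add_apply, Pi.zero_apply, h2] at h1
  rw [lp.coeFn_zero, Pi.zero_apply, h3]
  refine (mul_eq_zero_iff_left hne).1 ?_
  linear_combination h1

end Trigonometric

/-! ### Weyl elements -/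

section Weyl

/-- The phase `e^{2πiα}`. -/
def rotPhase (α : ℝ) : Circle := Circle.exp (2 * Real.pi * α)

theorem rotPhase_zpow (α : ℝ) (n : ℤ) : rotPhase α ^ n = Circle.exp (2 * Real.pi * α * n) := by
  rw [rotPhase, ← Circle.exp_intCast_mul, mul_comm (n : ℝ)]

theorem rotPhase_sq (α : ℝ) : rotPhase α ^ (2 : ℤ) = Circle.exp (4 * Real.pi * α) := by
  rw [rotPhase_zpow]
  congr 1
  push_cast
  ring

/-- The cocycle of the Weyl relations `W(a) W(b) = e^{2πiα(a₁b₂ - b₁a₂)} W(a + b)`. -/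
def weylPhase (α : ℝ) (a b : ℤ × ℤ) : Circle := rotPhase α ^ (a.1 * b.2 - b.1 * a.2)

/-- The scalars of modulus one as unitaries. -/
def scalarUnitary (B : Type*) [CStarAlgebra B] : Circle →* unitary B where
  toFun c := ⟨(c : ℂ) • (1 : B), by
    rw [Unitary.mem_iff, star_smul, star_one, smul_mul_smul_comm, smul_mul_smul_comm, mul_one,
      Complex.star_def, ← Circle.coe_inv_eq_conj, ← Circle.coe_mul, ← Circle.coe_mul,
      inv_mul_cancel, mul_inv_cancel, Circle.coe_one, one_smul]
    exact ⟨rfl, rfl⟩⟩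
  map_one' := Subtype.ext (by simp)
  map_mul' c d := Subtype.ext (by simp [smul_smul, mul_comm])

theorem coe_scalarUnitary_mul {B : Type*} [CStarAlgebra B] (c : Circle) (x : unitary B) :
    ((scalarUnitary B c * x : unitary B) : B) = (c : ℂ) • (x : B) := by
  change (c : ℂ) • (1 : B) * (x : B) = _
  rw [smul_mul_assoc, one_mul]

theorem commute_scalarUnitary {B : Type*} [CStarAlgebra B] (c : Circle) (x : unitary B) :
    Commute (scalarUnitary B c) x := Subtype.ext (by
  change (c : ℂ) • (1 : B) * (x : B) = x * ((c : ℂ) • (1 : B))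
  rw [smul_mul_assoc, one_mul, mul_smul_comm, mul_one])

theorem zpow_mul_zpow_of_central {G : Type*} [Group G] {u v z : G} (hz : ∀ g, Commute z g)
    (h : u * v = z * (v * u)) (m n : ℤ) : v ^ n * u ^ m = z ^ (-(m * n)) * (u ^ m * v ^ n) := by
  have hu_vn : SemiconjBy u (v ^ n) (z ^ n * v ^ n) := by
    have huv : SemiconjBy u v (z * v) := by rw [SemiconjBy, h, mul_assoc]
    have := huv.zpow_right n
    rwa [(hz v).mul_zpow] at this
  have hvn_u : SemiconjBy (v ^ n) u (z ^ (-n) * u) := by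
    rw [SemiconjBy, mul_assoc, hu_vn.eq, zpow_neg, mul_assoc, inv_mul_cancel_left]
  have hvn_um := hvn_u.zpow_right m
  rwa [((hz u).zpow_left (-n)).mul_zpow, ← zpow_mul, neg_mul, mul_comm n m, SemiconjBy,
    mul_assoc] at hvn_um

namespace NCTorus

variable (α : ℝ)

theorem coe_weyl (a : ℤ × ℤ) : weyl α a =
    ((scalarUnitary (NCTorus α) (rotPhase α ^ (-(a.1 * a.2))) * (U α ^ a.1 * V α ^ a.2) :
      unitary (NCTorus α)) : NCTorus α) := by
  rw [coe_scalarUnitary_mul, weyl, rotPhase_zpow]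
  congr 3
  push_cast
  ring

theorem weyl_zero : weyl α 0 = 1 := by
  simp only [weyl, Prod.fst_zero, Prod.snd_zero, Int.cast_zero, mul_zero, neg_zero, Circle.exp_zero,
    Circle.coe_one, one_smul, zpow_zero, mul_one, OneMemClass.coe_one]

theorem weyl_one_zero : weyl α (1, 0) = U α := by simp [weyl]

theorem weyl_zero_one : weyl α (0, 1) = V α := by simp [weyl]

theorem V_zpow_mul_U_zpow (m n : ℤ) : V α ^ n * U α ^ m =
    scalarUnitary (NCTorus α) (rotPhase α ^ (-(2 * (m * n)))) * (U α ^ m * V α ^ n) := by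
  have h : U α * V α = scalarUnitary (NCTorus α) (rotPhase α ^ (2 : ℤ)) * (V α * U α) :=
    Subtype.ext (by
      rw [coe_scalarUnitary_mul, rotPhase_sq]
      exact U_mul_V α)
  rw [zpow_mul_zpow_of_central (commute_scalarUnitary _) h, ← map_zpow, ← zpow_mul, mul_neg]

theorem weyl_mul_weyl (a b : ℤ × ℤ) :
    weyl α a * weyl α b = (weylPhase α a b : ℂ) • weyl α (a + b) := by
  have hUV : U α ^ a.1 * V α ^ a.2 * (U α ^ b.1 * V α ^ b.2) =
      scalarUnitary (NCTorus α) (rotPhase α ^ (-(2 * (b.1 * a.2)))) *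
        (U α ^ (a.1 + b.1) * V α ^ (a.2 + b.2)) :=
    calc U α ^ a.1 * V α ^ a.2 * (U α ^ b.1 * V α ^ b.2)
        = U α ^ a.1 * (V α ^ a.2 * U α ^ b.1) * V α ^ b.2 := by group
      _ = U α ^ a.1 * scalarUnitary (NCTorus α) (rotPhase α ^ (-(2 * (b.1 * a.2)))) *
            (U α ^ b.1 * V α ^ a.2 * V α ^ b.2) := by
          rw [V_zpow_mul_U_zpow]
          simp only [mul_assoc]
      _ = _ := by
          rw [← (commute_scalarUnitary _ (U α ^ a.1)).eq]
          group
  rw [coe_weyl, coe_weyl, coe_weyl, ← Submonoid.coe_mul, ← coe_scalarUnitary_mul, mul_assoc,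
    ← mul_assoc _ (scalarUnitary _ _), ← (commute_scalarUnitary _ (U α ^ a.1 * V α ^ a.2)).eq,
    mul_assoc, hUV]
  simp only [← mul_assoc, ← map_mul, weylPhase, ← zpow_add, Prod.fst_add, Prod.snd_add]
  congr 5
  ring

theorem weyl_neg_mul_weyl (a : ℤ × ℤ) : weyl α (-a) * weyl α a = 1 := by
  rw [weyl_mul_weyl, neg_add_cancel, weyl_zero, weylPhase, Prod.fst_neg, Prod.snd_neg,
    show -a.1 * a.2 - a.1 * -a.2 = 0 by ring, zpow_zero, Circle.coe_one, one_smul]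

theorem star_weyl (a : ℤ × ℤ) : star (weyl α a) = weyl α (-a) := by
  refine (left_inv_eq_right_inv (weyl_neg_mul_weyl α a) ?_).symm
  rw [coe_weyl]
  exact Unitary.coe_mul_star_self _

/-- The linear span of the Weyl elements, as a ⋆-subalgebra. -/
def weylSubalgebra : StarSubalgebra ℂ (NCTorus α) where
  toSubalgebra := (Submodule.span ℂ (Set.range (weyl α))).toSubalgebra
    (weyl_zero α ▸ Submodule.subset_span ⟨0, rfl⟩) fun x y hx hy => by
      have hxy := Submodule.mul_mem_mul hx hy
      rw [Submodule.span_mul_span] at hxy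
      refine Submodule.span_le.2 ?_ hxy
      rintro _ ⟨_, ⟨a, rfl⟩, _, ⟨b, rfl⟩, rfl⟩
      simp only [weyl_mul_weyl]
      exact Submodule.smul_mem _ _ (Submodule.subset_span ⟨_, rfl⟩)
  star_mem' {x} hx := by
    change star x ∈ Submodule.span ℂ (Set.range (weyl α))
    change x ∈ Submodule.span ℂ (Set.range (weyl α)) at hx
    induction hx using Submodule.span_induction with
    | mem x hx =>
      obtain ⟨a, rfl⟩ := hx
      rw [star_weyl]
      exact Submodule.subset_span ⟨_, rfl⟩
    | zero => rw [star_zero]; exact Submodule.zero_mem _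
    | add x y _ _ hx hy => rw [star_add]; exact Submodule.add_mem _ hx hy
    | smul c x _ hx => rw [star_smul]; exact Submodule.smul_mem _ _ hx

theorem span_weyl_closure_eq_top :
    (Submodule.span ℂ (Set.range (weyl α))).topologicalClosure = ⊤ := by
  let incl : NCTorus α →⋆ₐ[ℂ] TorusProduct α :=
    { toFun := Subtype.val
      map_one' := rfl
      map_mul' := fun _ _ => rfl
      map_zero' := rfl
      map_add' := fun _ _ => rfl
      commutes' := fun _ => rfl
      map_star' := fun _ => rfl }
  have hle : StarAlgebra.adjoin ℂ
      {(TorusProduct.ofUnitary (fun i : TorusPair α => i.u) : TorusProduct α),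
       (TorusProduct.ofUnitary (fun i : TorusPair α => i.v) : TorusProduct α)} ≤
      (weylSubalgebra α).map incl := by
    refine StarAlgebra.adjoin_le ?_
    rintro _ (rfl | rfl)
    · exact ⟨U α, weyl_one_zero α ▸ Submodule.subset_span ⟨_, rfl⟩, rfl⟩
    · exact ⟨V α, weyl_zero_one α ▸ Submodule.subset_span ⟨_, rfl⟩, rfl⟩
  exact Submodule.eq_top_iff'.2 fun x =>
    (closure_subtype (p := fun y => y ∈ torusSubalgebra α) (x := x)).2 (closure_mono hle x.2)

theorem exists_starAlgHom {B : Type} [CStarAlgebra B] (u v : unitary B)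
    (h : (u * v : B) = (Circle.exp (4 * Real.pi * α) : ℂ) • (v * u : B)) :
    ∃ φ : NCTorus α →⋆ₐ[ℂ] B, φ (U α) = u ∧ φ (V α) = v := by
  cases subsingleton_or_nontrivial B
  · let φ : NCTorus α →⋆ₐ[ℂ] B :=
      { toFun := 0
        map_one' := Subsingleton.elim _ _
        map_mul' := fun _ _ => Subsingleton.elim _ _
        map_zero' := rfl
        map_add' := fun _ _ => Subsingleton.elim _ _
        commutes' := fun _ => Subsingleton.elim _ _
        map_star' := fun _ => Subsingleton.elim _ _ }
    exact ⟨φ, Subsingleton.elim _ _, Subsingleton.elim _ _⟩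
  · exact (existsUnique_hom α ⟨B, u, v, h⟩).exists

end NCTorus

end Weyl

/-! ### The representation on `⨁ₙ L²(𝕋, μₙ)` -/

section Gram

theorem exists_linearIsometryEquiv_of_inner_eq {𝕜 ι H K : Type*} [RCLike 𝕜] [NormedAddCommGroup H]
    [InnerProductSpace 𝕜 H] [CompleteSpace H] [NormedAddCommGroup K] [InnerProductSpace 𝕜 K]
    [CompleteSpace K] {e : ι → H} {f : ι → K}
    (he : (Submodule.span 𝕜 (Set.range e)).topologicalClosure = ⊤)
    (hf : (Submodule.span 𝕜 (Set.range f)).topologicalClosure = ⊤)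
    (h : ∀ i j, ⟪f i, f j⟫_𝕜 = ⟪e i, e j⟫_𝕜) : ∃ T : H ≃ₗᵢ[𝕜] K, ∀ i, T (e i) = f i := by
  rw [← Submodule.dense_iff_topologicalClosure_eq_top, ← Finsupp.range_linearCombination] at he hf
  have hnorm (x : ι →₀ 𝕜) :
      ‖Finsupp.linearCombination 𝕜 f x‖ = ‖Finsupp.linearCombination 𝕜 e x‖ := by
    rw [@norm_eq_sqrt_re_inner 𝕜, @norm_eq_sqrt_re_inner 𝕜]
    simp only [Finsupp.linearCombination_apply, Finsupp.sum_inner, Finsupp.inner_sum,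
      inner_smul_left, inner_smul_right, h]
  refine ⟨(LinearEquiv.refl 𝕜 (ι →₀ 𝕜)).extendOfIsometry _ _ he hf hnorm, fun i => ?_⟩
  simpa using LinearEquiv.extendOfIsometry_eq (LinearEquiv.refl 𝕜 (ι →₀ 𝕜)) _ _ he hf hnorm
    (Finsupp.single i 1)

end Gram

section Representation

variable (α : ℝ) (μ : Measure Circle)

instance isFiniteMeasure_rotMeasure [IsFiniteMeasure μ] (n : ℤ) :
    IsFiniteMeasure (rotMeasure α μ n) :=
  Measure.isFiniteMeasure_map _ _

theorem rotMeasure_zero : rotMeasure α μ 0 = μ := by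
  simp [rotMeasure]

theorem integral_circlePow_rotMeasure (k n : ℤ) : ∫ z, circlePow k z ∂(rotMeasure α μ n) =
    ((rotPhase α ^ (n * k) : Circle) : ℂ) * ∫ z, circlePow k z ∂μ := by
  rw [rotMeasure, integral_map (continuous_const_mul _).aemeasurable
    (circlePow k).continuous.aestronglyMeasurable, ← integral_const_mul]
  simp only [circlePow_apply, ← rotPhase_zpow, mul_zpow, ← zpow_mul, Circle.coe_mul]

theorem weylPhase_mul_weylPhase (a b c : ℤ × ℤ) :
    weylPhase α b c * weylPhase α a (b + c) = weylPhase α a b * weylPhase α (a + b) c := by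
  simp only [weylPhase, ← zpow_add, Prod.fst_add, Prod.snd_add]
  congr 1
  ring

theorem inner_weylPhase_smul_trigVec [IsFiniteMeasure μ] (b a c : ℤ × ℤ) :
    ⟪(weylPhase α b a : ℂ) • trigVec (rotMeasure α μ) (b + a),
      (weylPhase α b c : ℂ) • trigVec (rotMeasure α μ) (b + c)⟫_ℂ =
      ⟪trigVec (rotMeasure α μ) a, trigVec (rotMeasure α μ) c⟫_ℂ := by
  rw [inner_smul_left, inner_smul_right, inner_trigVec_trigVec, inner_trigVec_trigVec]
  simp only [Prod.fst_add, Prod.snd_add, add_right_inj, add_sub_add_left_eq_sub]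
  split_ifs with h
  · rw [integral_circlePow_rotMeasure, integral_circlePow_rotMeasure, ← Circle.coe_inv_eq_conj,
      ← mul_assoc, ← mul_assoc, ← Circle.coe_mul, ← Circle.coe_mul, weylPhase, weylPhase,
      ← zpow_neg, ← zpow_add, ← zpow_add, h]
    congr 4
    ring
  · rw [mul_zero, mul_zero]

theorem exists_weylShift [IsFiniteMeasure μ] (b : ℤ × ℤ) :
    ∃ T : rotHilbert α μ ≃ₗᵢ[ℂ] rotHilbert α μ, ∀ a, T (trigVec (rotMeasure α μ) a) =
      (weylPhase α b a : ℂ) • trigVec (rotMeasure α μ) (b + a) := by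
  refine exists_linearIsometryEquiv_of_inner_eq span_trigVec_closure_eq_top ?_
    (inner_weylPhase_smul_trigVec α μ b)
  rw [eq_top_iff, ← span_trigVec_closure_eq_top (ν := rotMeasure α μ)]
  refine Submodule.topologicalClosure_mono (Submodule.span_le.2 ?_)
  rintro _ ⟨a, rfl⟩
  have ha := Submodule.smul_mem _ ((weylPhase α b (-b + a) : ℂ)⁻¹)
    (Submodule.subset_span (R := ℂ) (Set.mem_range_self
      (f := fun c => (weylPhase α b c : ℂ) • trigVec (rotMeasure α μ) (b + c)) (-b + a)))
  rwa [smul_smul, inv_mul_cancel₀ (Circle.coe_ne_zero _), one_smul, add_neg_cancel_left] at ha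

theorem apply_weyl_of_apply_U_of_apply_V {H : Type*} [NormedAddCommGroup H]
    [InnerProductSpace ℂ H] [CompleteSpace H] {α : ℝ} {φ : NCTorus α →⋆ₐ[ℂ] (H →L[ℂ] H)}
    {e : ℤ × ℤ → H}
    (hU : ∀ a, φ (NCTorus.U α) (e a) = (weylPhase α (1, 0) a : ℂ) • e ((1, 0) + a))
    (hV : ∀ a, φ (NCTorus.V α) (e a) = (weylPhase α (0, 1) a : ℂ) • e ((0, 1) + a))
    (b a : ℤ × ℤ) : φ (NCTorus.weyl α b) (e a) = (weylPhase α b a : ℂ) • e (b + a) := by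
  let G : AddSubgroup (ℤ × ℤ) :=
    { carrier := {b | ∀ a, φ (NCTorus.weyl α b) (e a) = (weylPhase α b a : ℂ) • e (b + a)}
      zero_mem' := fun a => by simp [NCTorus.weyl_zero, weylPhase]
      add_mem' := fun {b c} hb hc a => by
        have h := DFunLike.congr_fun (congrArg φ (NCTorus.weyl_mul_weyl α b c)) (e a)
        rw [map_mul, map_smul, mul_apply_eq_comp, hc, map_smul, hb, smul_smul,
          ← Circle.coe_mul, weylPhase_mul_weylPhase, Circle.coe_mul, mul_smul, ← add_assoc] at h
        exact (smul_right_injective _ (Circle.coe_ne_zero _) h).symm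
      neg_mem' := fun {b} hb a => by
        have h := DFunLike.congr_fun (congrArg φ (NCTorus.weyl_neg_mul_weyl α b)) (e (-b + a))
        have hphase : weylPhase α (-b) a * weylPhase α b (-b + a) = 1 := by
          rw [weylPhase, weylPhase, ← zpow_add, ← zpow_zero (rotPhase α)]
          simp only [Prod.fst_add, Prod.snd_add, Prod.fst_neg, Prod.snd_neg]
          congr 1
          ring
        rw [map_mul, mul_apply_eq_comp, hb, add_neg_cancel_left, map_smul, map_one,
          one_apply_eq_self] at h
        rw [← h, smul_smul, ← Circle.coe_mul, hphase, Circle.coe_one, one_smul] }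
  have h10 : ((1, 0) : ℤ × ℤ) ∈ G := fun a => by rw [NCTorus.weyl_one_zero, hU]
  have h01 : ((0, 1) : ℤ × ℤ) ∈ G := fun a => by rw [NCTorus.weyl_zero_one, hV]
  have hb : b = b.1 • (1, 0) + b.2 • (0, 1) := by ext <;> simp
  exact hb ▸ G.add_mem (G.zsmul_mem h10 _) (G.zsmul_mem h01 _) a

theorem exists_weylRep [IsFiniteMeasure μ] :
    ∃ φ : NCTorus α →⋆ₐ[ℂ] (rotHilbert α μ →L[ℂ] rotHilbert α μ), ∀ a,
      φ (NCTorus.weyl α a) (trigVec (rotMeasure α μ) 0) = trigVec (rotMeasure α μ) a := by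
  obtain ⟨u, hu⟩ := exists_weylShift α μ (1, 0)
  obtain ⟨v, hv⟩ := exists_weylShift α μ (0, 1)
  obtain ⟨φ, hφU, hφV⟩ := NCTorus.exists_starAlgHom α (Unitary.linearIsometryEquiv.symm u)
    (Unitary.linearIsometryEquiv.symm v) <| by
      refine ContinuousLinearMap.ext_on (Submodule.dense_iff_topologicalClosure_eq_top.2
        (span_trigVec_closure_eq_top (ν := rotMeasure α μ))) ?_
      rintro _ ⟨a, rfl⟩
      change u (v (trigVec _ a)) = (Circle.exp (4 * Real.pi * α) : ℂ) • v (u (trigVec _ a))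
      rw [hu, hv, map_smul, map_smul, hu, hv, smul_smul, smul_smul, smul_smul, ← rotPhase_sq,
        add_left_comm, ← Circle.coe_mul, ← Circle.coe_mul, ← Circle.coe_mul]
      simp only [weylPhase, ← zpow_add, Prod.fst_add, Prod.snd_add]
      congr 3
      ring
  refine ⟨φ, fun a => ?_⟩
  rw [apply_weyl_of_apply_U_of_apply_V (fun a => hφU ▸ hu a) (fun a => hφV ▸ hv a)]
  simp [weylPhase]

end Representation

/-! ### Vector functionals and their Tomita operators -/

namespace IsPolarDecomposition

variable {H : Type*} [NormedAddCommGroup H] [InnerProductSpace ℂ H] [CompleteSpace H]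
  {S : Set (H × H)} {J : H ≃ₗᵢ⋆[ℂ] H} {T : H →ₗ.[ℂ] H}

theorem mem_iff_symm (h : IsPolarDecomposition S J T) {x y : H} :
    (x, y) ∈ S ↔ (x, J.symm y) ∈ T.graph := by
  rw [← h.mem_iff, J.apply_symm_apply]

theorem isClosed (h : IsPolarDecomposition S J T) : IsClosed S := by
  have hS : S = (fun p : H × H => (p.1, J.symm p.2)) ⁻¹' T.graph := by
    ext p
    exact h.mem_iff_symm
  rw [hS]
  exact h.isSelfAdjoint.isClosed.preimage (by fun_prop)

theorem subset_closure_of_core (h : IsPolarDecomposition S J T) {D : Submodule ℂ H}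
    (hD : T.graph ≤ (T.domRestrict D).graph.topologicalClosure) :
    S ⊆ closure {p ∈ S | p.1 ∈ D} := by
  rintro ⟨x, y⟩ hxy
  have hmaps : Set.MapsTo (fun p : H × H => (p.1, J p.2)) (T.domRestrict D).graph
      {p ∈ S | p.1 ∈ D} := by
    intro p hp
    exact ⟨h.mem_iff.2 (LinearPMap.le_graph_of_le LinearPMap.domRestrict_le hp),
      (LinearPMap.mem_domain_of_mem_graph hp).1⟩
  have hclosure := map_mem_closure (by fun_prop) (hD (h.mem_iff_symm.1 hxy)) hmaps
  rwa [J.apply_symm_apply] at hclosure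

variable {A : Type*} [CStarAlgebra A] {φ : A →⋆ₐ[ℂ] (H →L[ℂ] H)} {ξ : H} {s : Set A}

open scoped CStarAlgebra in
theorem mem_of_span_closure_eq_top (h : IsPolarDecomposition S J T)
    (hs : (Submodule.span ℂ s).topologicalClosure = ⊤)
    (hsS : ∀ a ∈ s, (φ a ξ, φ (star a) ξ) ∈ S) (a : A) : (φ a ξ, φ (star a) ξ) ∈ S := by
  let L : A →ₗ[ℂ] H × H :=
    { toFun := fun a => (φ a ξ, J.symm (φ (star a) ξ))
      map_add' := fun a b => by simp
      map_smul' := fun c a => by simp [J.symm.map_smulₛₗ] }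
  have hL (a : A) : (φ a ξ, φ (star a) ξ) ∈ S ↔ a ∈ T.graph.comap L := h.mem_iff_symm
  have hcont : Continuous L := by
    have hφ : Continuous φ := map_continuous φ
    change Continuous fun a => (φ a ξ, J.symm (φ (star a) ξ))
    fun_prop
  have hle : (Submodule.span ℂ s).topologicalClosure ≤ T.graph.comap L :=
    Submodule.topologicalClosure_minimal _ (Submodule.span_le.2 fun a ha => (hL a).1 (hsS a ha))
      (h.isSelfAdjoint.isClosed.preimage hcont)
  exact (hL a).2 (hle (hs ▸ Submodule.mem_top))

theorem closure_range_eq (h : IsPolarDecomposition S J T)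
    (hs : (Submodule.span ℂ s).topologicalClosure = ⊤)
    (hsS : ∀ a ∈ s, (φ a ξ, φ (star a) ξ) ∈ S) {D : Submodule ℂ H} (hD : ∀ x ∈ D, ∃ a, φ a ξ = x)
    (hcore : T.graph ≤ (T.domRestrict D).graph.topologicalClosure) :
    closure (Set.range fun a => (φ a ξ, φ (star a) ξ)) = S := by
  have hmem := h.mem_of_span_closure_eq_top hs hsS
  refine (closure_minimal (Set.range_subset_iff.2 hmem) h.isClosed).antisymm
    ((h.subset_closure_of_core hcore).trans (closure_mono ?_))
  rintro ⟨x, y⟩ ⟨hxy, hx⟩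
  obtain ⟨a, rfl⟩ := hD x hx
  refine ⟨a, Prod.ext rfl (J.symm.injective ?_)⟩
  exact T.mem_graph_snd_inj (h.mem_iff_symm.1 (hmem a)) (h.mem_iff_symm.1 hxy) rfl

end IsPolarDecomposition

section VectorFunctional

theorem inner_apply_apply {A H : Type*} [CStarAlgebra A] [NormedAddCommGroup H]
    [InnerProductSpace ℂ H] [CompleteSpace H] (φ : A →⋆ₐ[ℂ] (H →L[ℂ] H)) (ξ : H) (a b : A) :
    ⟪φ a ξ, φ b ξ⟫_ℂ = ⟪ξ, φ (star a * b) ξ⟫_ℂ := by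
  rw [map_mul, map_star, ContinuousLinearMap.star_eq_adjoint, mul_apply_eq_comp,
    ContinuousLinearMap.adjoint_inner_right]

variable {A H : Type*} [CStarAlgebra A] [PartialOrder A] [StarOrderedRing A]
  [NormedAddCommGroup H] [InnerProductSpace ℂ H] [CompleteSpace H]

/-- The positive functional `a ↦ ⟪ξ, φ(a) ξ⟫` of a vector `ξ` in a representation `φ`. -/
def vectorFunctional (φ : A →⋆ₐ[ℂ] (H →L[ℂ] H)) (ξ : H) : A →ₚ[ℂ] ℂ :=
  PositiveLinearMap.mk₀
    { toFun := fun a => ⟪ξ, φ a ξ⟫_ℂ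
      map_add' := fun a b => by simp
      map_smul' := fun c a => by simp }
    fun a ha => by
      obtain ⟨b, rfl⟩ := CStarAlgebra.nonneg_iff_eq_star_mul_self.1 ha
      change 0 ≤ ⟪ξ, φ (star b * b) ξ⟫_ℂ
      rw [← inner_apply_apply, inner_self_eq_norm_sq_to_K]
      exact pow_nonneg (Complex.zero_le_real.2 (norm_nonneg (φ b ξ))) 2

theorem vectorFunctional_apply (φ : A →⋆ₐ[ℂ] (H →L[ℂ] H)) (ξ : H) (a : A) :
    vectorFunctional φ ξ a = ⟪ξ, φ a ξ⟫_ℂ := rfl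

theorem gnsStarAlgHom_gnsVector (ω : A →ₚ[ℂ] ℂ) (a : A) :
    ω.gnsStarAlgHom a (gnsVector ω) = ((ω.toPreGNS a : ω.PreGNS) : ω.GNS) := by
  change ω.gnsNonUnitalStarAlgHom a ((ω.toPreGNS 1 : ω.PreGNS) : ω.GNS) = _
  rw [PositiveLinearMap.gnsNonUnitalStarAlgHom_apply_coe,
    PositiveLinearMap.leftMulMapPreGNS_apply]
  simp

theorem denseRange_gnsStarAlgHom_gnsVector (ω : A →ₚ[ℂ] ℂ) :
    DenseRange fun a => ω.gnsStarAlgHom a (gnsVector ω) := by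
  simp only [gnsStarAlgHom_gnsVector]
  exact UniformSpace.Completion.denseRange_coe.comp ω.toPreGNS.surjective.denseRange
    (UniformSpace.Completion.continuous_coe _)

theorem inner_gnsStarAlgHom_gnsVector (ω : A →ₚ[ℂ] ℂ) (a b : A) :
    ⟪ω.gnsStarAlgHom a (gnsVector ω), ω.gnsStarAlgHom b (gnsVector ω)⟫_ℂ = ω (star a * b) := by
  rw [gnsStarAlgHom_gnsVector, gnsStarAlgHom_gnsVector, UniformSpace.Completion.inner_coe]
  simp [PositiveLinearMap.preGNS_inner_def]

theorem exists_gnsEquiv_vectorFunctional (φ : A →⋆ₐ[ℂ] (H →L[ℂ] H)) (ξ : H)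
    (hξ : DenseRange fun a => φ a ξ) :
    ∃ Φ : (vectorFunctional φ ξ).GNS ≃ₗᵢ[ℂ] H, ∀ a,
      Φ ((vectorFunctional φ ξ).gnsStarAlgHom a (gnsVector (vectorFunctional φ ξ))) = φ a ξ := by
  refine exists_linearIsometryEquiv_of_inner_eq
    (Submodule.dense_iff_topologicalClosure_eq_top.1
      ((denseRange_gnsStarAlgHom_gnsVector _).mono Submodule.subset_span))
    (Submodule.dense_iff_topologicalClosure_eq_top.1 (hξ.mono Submodule.subset_span))
    fun a b => ?_
  rw [inner_gnsStarAlgHom_gnsVector, inner_apply_apply, vectorFunctional_apply]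

theorem tomitaGraph_eq_preimage {ω : A →ₚ[ℂ] ℂ} {φ : A →⋆ₐ[ℂ] (H →L[ℂ] H)} {ξ : H}
    (Φ : ω.GNS ≃ₗᵢ[ℂ] H) (hΦ : ∀ a, Φ (ω.gnsStarAlgHom a (gnsVector ω)) = φ a ξ) :
    tomitaGraph ω =
      Prod.map Φ Φ ⁻¹' closure (Set.range fun a => (φ a ξ, φ (star a) ξ)) := by
  let E : ω.GNS × ω.GNS ≃ₜ H × H := Φ.toHomeomorph.prodCongr Φ.toHomeomorph
  change _ = E ⁻¹' _
  rw [E.preimage_closure, tomitaGraph]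
  congr 1
  ext p
  refine exists_congr fun a => ?_
  rw [← E.injective.eq_iff, eq_comm]
  simp only [← hΦ]
  rfl

end VectorFunctional

/-! ### The states `ω_μ` -/

section State

theorem tsum_mul_row {ι κ : Type*} [DecidableEq κ] (k : ι → ℂ) (f : ι × κ →₀ ℂ) (n : κ) :
    ∑' m, k m * f (m, n) = f.sum fun a c => if a.2 = n then k a.1 * c else 0 := by
  let F : ι × κ → ℂ := fun a => if a.2 = n then k a.1 * f a else 0
  have hrow : ∑' m, F (m, n) = ∑' a, F a :=
    (Prod.mk_left_injective n).tsum_eq fun a ha =>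
      ⟨a.1, Prod.ext rfl (by_contra fun hne => ha (if_neg (Ne.symm hne)))⟩
  have hsupport : ∑' a, F a = ∑ a ∈ f.support, F a := tsum_eq_sum fun a ha => by
    simp only [F, Finsupp.notMem_support_iff.1 ha, mul_zero, ite_self]
  simpa only [F, if_true, Finsupp.sum] using hrow.trans hsupport

theorem rowTransform_eq_sum (f : ℤ × ℤ →₀ ℂ) (n : ℤ) (z : Circle) :
    rowTransform f n z = f.sum fun a c => if a.2 = n then circlePow a.1 z * c else 0 := by
  rw [rowTransform, ← tsum_mul_row fun m => circlePow m z]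
  simp only [circlePow_apply, mul_comm]

theorem sum_smul_trigVec_ae {ν : ℤ → Measure Circle} [∀ n, IsFiniteMeasure (ν n)]
    (f : ℤ × ℤ →₀ ℂ) (n : ℤ) :
    (f.sum fun a c => c • trigVec ν a) n =ᵐ[ν n] rowTransform f n := by
  induction f using Finsupp.induction_linear with
  | zero =>
    filter_upwards [Lp.coeFn_zero ℂ 2 (ν n)] with z hz
    rw [rowTransform_eq_sum, Finsupp.sum_zero_index, Finsupp.sum_zero_index]
    exact hz
  | add f g hf hg =>
    rw [Finsupp.sum_add_index' (fun a => zero_smul ℂ (trigVec ν a)) fun a b c => add_smul b c _]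
    filter_upwards [hf, hg, Lp.coeFn_add ((f.sum fun a c => c • trigVec ν a) n)
      ((g.sum fun a c => c • trigVec ν a) n)] with z h1 h2 h3
    have hadd : rowTransform (f + g) n z = rowTransform f n z + rowTransform g n z := by
      simp only [rowTransform_eq_sum]
      exact Finsupp.sum_add_index' (by simp) fun a b c => by split_ifs <;> simp [mul_add]
    rw [hadd, ← h1, ← h2]
    exact h3
  | single a c =>
    rw [Finsupp.sum_single_index (zero_smul ℂ (trigVec ν a))]
    filter_upwards [Lp.coeFn_smul c (trigVec ν a n), trigVec_ae a n] with z h1 h2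
    rw [rowTransform_eq_sum, Finsupp.sum_single_index (by simp)]
    refine h1.trans ?_
    rw [Pi.smul_apply, h2]
    simp only [smul_eq_mul, eq_comm (a := n), mul_comm c, ite_mul, zero_mul]

theorem NCTorus.denseRange_W (α : ℝ) : DenseRange (NCTorus.W α) := by
  have h := NCTorus.span_weyl_closure_eq_top α
  rwa [← Submodule.dense_iff_topologicalClosure_eq_top, ← Finsupp.range_linearCombination] at h

variable {α : ℝ}

theorem IsOmega.unique {μ : Measure Circle} {ω ω' : NCTorus α →ₚ[ℂ] ℂ} (h : IsOmega α μ ω)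
    (h' : IsOmega α μ ω') : ω = ω' :=
  DFunLike.coe_injective <| (NCTorus.denseRange_W α).equalizer (map_continuous ω)
    (map_continuous ω') (funext fun f => (h f).trans (h' f).symm)

section CyclicRepresentation

variable {H : Type*} [NormedAddCommGroup H] [InnerProductSpace ℂ H] [CompleteSpace H]
  {φ : NCTorus α →⋆ₐ[ℂ] (H →L[ℂ] H)} {ξ : H} {e : ℤ × ℤ → H}

theorem apply_W_of_apply_weyl (hφ : ∀ a, φ (NCTorus.weyl α a) ξ = e a) (f : ℤ × ℤ →₀ ℂ) :
    φ (NCTorus.W α f) ξ = f.sum fun a c => c • e a := by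
  simp only [NCTorus.W, Finsupp.sum, map_sum, map_smul, _root_.sum_apply, _root_.smul_apply, hφ]

theorem exists_apply_eq_of_mem_span (hφ : ∀ a, φ (NCTorus.weyl α a) ξ = e a) {x : H}
    (hx : x ∈ Submodule.span ℂ (Set.range e)) : ∃ a, φ a ξ = x := by
  obtain ⟨f, rfl⟩ := Finsupp.mem_span_range_iff_exists_finsupp.1 hx
  exact ⟨NCTorus.W α f, apply_W_of_apply_weyl hφ f⟩

theorem denseRange_of_apply_weyl (hφ : ∀ a, φ (NCTorus.weyl α a) ξ = e a)
    (he : (Submodule.span ℂ (Set.range e)).topologicalClosure = ⊤) :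
    DenseRange fun a => φ a ξ :=
  (Submodule.dense_iff_topologicalClosure_eq_top.2 he).mono fun _ =>
    exists_apply_eq_of_mem_span hφ

end CyclicRepresentation

theorem mk_trigVec_mem_reflectionGraph {ν : ℤ → Measure Circle} [∀ n, IsFiniteMeasure (ν n)]
    (hν : ∀ n, ν (-n) ≪ ν n) (a : ℤ × ℤ) : (trigVec ν a, trigVec ν (-a)) ∈ reflectionGraph ν := by
  intro n
  filter_upwards [trigVec_ae (-a) n, absolutelyContinuous_neg hν n (trigVec_ae a (-n))]
    with z h1 h2
  rw [h1, h2]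
  simp only [Prod.fst_neg, Prod.snd_neg, neg_eq_iff_eq_neg, apply_ite conj, map_zero,
    conj_circlePow]

theorem closure_range_eq_reflectionGraph {ν : ℤ → Measure Circle} [∀ n, IsFiniteMeasure (ν n)]
    (hν : ∀ n, ν (-n) ≪ ν n)
    {φ : NCTorus α →⋆ₐ[ℂ] (lp (fun n => Lp ℂ 2 (ν n)) 2 →L[ℂ] lp (fun n => Lp ℂ 2 (ν n)) 2)}
    (hφ : ∀ a, φ (NCTorus.weyl α a) (trigVec ν 0) = trigVec ν a) :
    closure (Set.range fun a => (φ a (trigVec ν 0), φ (star a) (trigVec ν 0))) =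
      reflectionGraph ν := by
  refine (isPolarDecomposition_reflectionGraph hν).closure_range_eq
    (NCTorus.span_weyl_closure_eq_top α) ?_ (fun x => exists_apply_eq_of_mem_span hφ)
    (graph_mulOp_le_closure_span_trigVec fun n => memLp_sqrt_negDensity)
  rintro _ ⟨a, rfl⟩
  rw [NCTorus.star_weyl, hφ, hφ]
  exact mk_trigVec_mem_reflectionGraph hν a

variable {μ : Measure Circle} [IsFiniteMeasure μ]
  {φ : NCTorus α →⋆ₐ[ℂ] (rotHilbert α μ →L[ℂ] rotHilbert α μ)}

theorem isOmega_vectorFunctional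
    (hφ : ∀ a, φ (NCTorus.weyl α a) (trigVec (rotMeasure α μ) 0) = trigVec (rotMeasure α μ) a) :
    IsOmega α μ (vectorFunctional φ (trigVec (rotMeasure α μ) 0)) := by
  intro f
  rw [vectorFunctional_apply, apply_W_of_apply_weyl hφ, Finsupp.inner_sum]
  refine Eq.trans ?_ (tsum_mul_row (fun m => ∫ z, circlePow m z ∂μ) f 0).symm
  refine Finsupp.sum_congr fun a _ => ?_
  rw [inner_smul_right, inner_trigVec_trigVec, Prod.snd_zero, Prod.fst_zero, sub_zero,
    rotMeasure_zero]
  simp only [eq_comm (a := (0 : ℤ)), mul_comm (f a), ite_mul, zero_mul]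

theorem tomitaGraph_eq_preimage_reflectionGraph
    (hμ : ∀ n, rotMeasure α μ (-n) ≪ rotMeasure α μ n)
    (hφ : ∀ a, φ (NCTorus.weyl α a) (trigVec (rotMeasure α μ) 0) = trigVec (rotMeasure α μ) a)
    {ω : NCTorus α →ₚ[ℂ] ℂ} (Φ : ω.GNS ≃ₗᵢ[ℂ] rotHilbert α μ)
    (hΦ : ∀ a, Φ (ω.gnsStarAlgHom a (gnsVector ω)) = φ a (trigVec (rotMeasure α μ) 0)) :
    tomitaGraph ω = Prod.map Φ Φ ⁻¹' reflectionGraph (rotMeasure α μ) := by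
  rw [tomitaGraph_eq_preimage Φ hΦ, closure_range_eq_reflectionGraph hμ hφ]

end State

end

theorem mainTheorem9_general (α : ℝ) (μ : Measure Circle) [IsFiniteMeasure μ]
    (hμ : ∀ n : ℤ, rotMeasure α μ (-n) ≪ rotMeasure α μ n) :
    (∃! ω : NCTorus α →ₚ[ℂ] ℂ, IsOmega α μ ω) ∧
    ∀ ω : NCTorus α →ₚ[ℂ] ℂ, IsOmega α μ ω →
      ∃ Φ : ω.GNS ≃ₗᵢ[ℂ] rotHilbert α μ, IsGNSModel μ ω Φ ∧
        (∃ (Δ : ω.GNS →ₗ.[ℂ] ω.GNS) (J : ω.GNS ≃ₗᵢ⋆[ℂ] ω.GNS), IsModularPair ω Δ J) ∧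
        ∀ (Δ : ω.GNS →ₗ.[ℂ] ω.GNS) (J : ω.GNS ≃ₗᵢ⋆[ℂ] ω.GNS), IsModularPair ω Δ J →
          (∀ x : ω.GNS, x ∈ Δ.domain ↔
            ∑' n : ℤ, ∫⁻ z, ‖(rotDensity α μ n z : ℂ) * Φ x n z‖ₑ ^ 2 ∂(rotMeasure α μ n) < ∞) ∧
          (∀ (x : Δ.domain) (n : ℤ),
            Φ (Δ x) n =ᵐ[rotMeasure α μ n] fun z => (rotDensity α μ n z : ℂ) * Φ x n z) ∧
          (∀ (x : ω.GNS) (n : ℤ),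
            Φ (J x) n =ᵐ[rotMeasure α μ n]
              fun z => (√(rotDensity α μ n z) : ℂ) * conj (Φ x (-n) z)) := by
  obtain ⟨φ, hφ⟩ := exists_weylRep α μ
  have hω := isOmega_vectorFunctional hφ
  refine ⟨⟨_, hω, fun ω' h' => h'.unique hω⟩, fun ω h => ?_⟩
  obtain rfl := h.unique hω
  obtain ⟨Φ, hΦ⟩ := exists_gnsEquiv_vectorFunctional φ _
    (denseRange_of_apply_weyl hφ span_trigVec_closure_eq_top)
  have htomita := tomitaGraph_eq_preimage_reflectionGraph hμ hφ Φ hΦ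
  have hmeas (n : ℤ) : AEMeasurable (rotDensity α μ n) (rotMeasure α μ n) :=
    (measurable_negDensity n).aemeasurable
  have hpolar := (isPolarDecomposition_reflectionGraph hμ).conj Φ
  have hsq := (isOperatorSquare_mulOp_sqrt hmeas fun _ _ => negDensity_nonneg _ _).conj Φ
  rw [← htomita] at hpolar
  refine ⟨Φ, fun f n => ?_, ⟨_, _, _, hpolar, hsq⟩, ?_⟩
  · rw [hΦ, apply_W_of_apply_weyl hφ]
    exact sum_smul_trigVec_ae f n
  rintro Δ J ⟨T, hT, hΔ⟩
  obtain rfl := hT.eq_right hpolar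
  obtain rfl := hT.eq_left hpolar fun x hx => by
    rw [htomita, Set.mem_preimage, Prod.map_apply, map_zero] at hx
    exact (map_eq_zero_iff Φ Φ.injective).1 (eq_zero_of_mk_zero_mem_reflectionGraph hμ hx)
  obtain rfl := hΔ.eq hsq
  refine ⟨fun x => (mem_domain_conjOp Φ).trans (mem_domain_mulOp_iff hmeas), fun x =>
    mem_graph_mulOp.1 ((mem_graph_conjOp Φ).1 (LinearPMap.mem_graph _ x)), fun x => ?_⟩
  rw [LinearIsometryEquiv.trans_apply, LinearIsometryEquiv.trans_apply, Φ.apply_symm_apply]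
  exact modularConj_ae hμ (Φ x)

theorem mainTheorem9 (α : ℝ) (hα : Irrational α)
    (μ : Measure Circle) [IsProbabilityMeasure μ]
    (hμ : ∀ n : ℤ, rotMeasure α μ (-n) ≪ rotMeasure α μ n ∧
      rotMeasure α μ n ≪ rotMeasure α μ (-n)) :
    (∃! ω : NCTorus α →ₚ[ℂ] ℂ, IsOmega α μ ω) ∧
    ∀ ω : NCTorus α →ₚ[ℂ] ℂ, IsOmega α μ ω →
      ∃ Φ : ω.GNS ≃ₗᵢ[ℂ] rotHilbert α μ, IsGNSModel μ ω Φ ∧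
        (∃ (Δ : ω.GNS →ₗ.[ℂ] ω.GNS) (J : ω.GNS ≃ₗᵢ⋆[ℂ] ω.GNS), IsModularPair ω Δ J) ∧
        ∀ (Δ : ω.GNS →ₗ.[ℂ] ω.GNS) (J : ω.GNS ≃ₗᵢ⋆[ℂ] ω.GNS), IsModularPair ω Δ J →
          (∀ x : ω.GNS, x ∈ Δ.domain ↔
            ∑' n : ℤ, ∫⁻ z, ‖(rotDensity α μ n z : ℂ) * Φ x n z‖ₑ ^ 2 ∂(rotMeasure α μ n) < ∞) ∧
          (∀ (x : Δ.domain) (n : ℤ),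
            Φ (Δ x) n =ᵐ[rotMeasure α μ n] fun z => (rotDensity α μ n z : ℂ) * Φ x n z) ∧
          (∀ (x : ω.GNS) (n : ℤ),
            Φ (J x) n =ᵐ[rotMeasure α μ n]
              fun z => (√(rotDensity α μ n z) : ℂ) * conj (Φ x (-n) z)) :=
  mainTheorem9_general α μ fun n => (hμ n).1
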